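/- Let $\mathfrak n$ be a socle Lie algebra over $\mathbb C$, i.e. a complex Lie algebra which is the union of an increasing sequence $\mathfrak n_1\subseteq\mathfrak n_2\subseteq\cdots$ of finite-dimensional nilpotent ideals; fix such a sequence. Let $\mathfrak n^*$ be the dual space of $\mathfrak n$, and let $\mathrm S(\mathfrak n)$ be the symmetric algebra of $\mathfrak n$ with the Poisson bracket determined by $\{x,y\}=[x,y]$ for $x,y\in\mathfrak n$. Elements of $\mathrm S(\mathfrak n)$ are regarded as polynomial functions on $\mathfrak n^*$. A subset of $\mathfrak n^*$ is closed in the $\mathrm S(\mathfrak n)$-Zariski topology if it is the set of common zeros of some subset of $\mathrm S(\mathfrak n)$. For $\lambda\in\mathfrak n^*$ let $I(\lambda)$ be the largest Poisson ideal of $\mathrm S(\mathfrak n)$ contained in the maximal ideal $\{f\in\mathrm S(\mathfrak n): f(\lambda)=0\}$. For each $l$ let $N_l=\operatorname{Exp}\mathfrak n_l$ be the unipotent group with Lie algebra $\mathfrak n_l$. For $l\ge k$ it acts on the ideal $\mathfrak n_k$ by the adjoint action and on $\mathfrak n_k^*$ by the dual (coadjoint) action $\rho_k^l\colon N_l\to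 \mathrm{GL}(\mathfrak n_k^*)$. Put $\widehat N_k=\bigcup_{l\ge k}\rho_k^l(N_l)\subseteq \mathrm{GL}(\mathfrak n_k^*)$ and $\widehat N=\varprojlim_k\widehat N_k$, the transition maps being induced by the restriction maps $\mathfrak n_{k+1}^*\to\mathfrak n_k^*$. The group $\widehat N$ acts on $\mathfrak n^*=\varprojlim_k\mathfrak n_k^*$; this action is called coadjoint. Then every coadjoint $\widehat N$-orbit $\Omega\subseteq\mathfrak n^*$ is a closed pro-subvariety of $\mathfrak n^*$: it is closed in the $\mathrm S(\mathfrak n)$-Zariski topology; it is the projective limit of Zariski closed subsets $X_k\subseteq\mathfrak n_k^*$ along restriction maps $X_{k+1}\to X_k$ with Zariski dense image; and, for every $\lambda\in\Omega$, $$\Omega=\{\mu\in\mathfrak n^* : f(\mu)=0\ \text{for all } f\in I(\lambda)\}.$$ -/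

import Mathlib

open scoped Topology

noncomputable section

/-! ## The Poisson algebra `S(V)` of a Lie algebra -/

section Poisson

/-- The derivation of the symmetric algebra `S(V)`, with values in an `S(V)`-module `M`, that
extends a given linear map `f : V → M`. It is the second component of the algebra homomorphism
`S(V) → S(V) ⊕ M` (the trivial square-zero extension) induced by `v ↦ (v, f v)`. -/
def symDerivation {V M : Type*} [AddCommGroup V] [Module ℂ V] [AddCommGroup M]
    [Module ℂ M] [Module (SymmetricAlgebra ℂ V) M] [Module (SymmetricAlgebra ℂ V)ᵐᵒᵖ M]
    [IsCentralScalar (SymmetricAlgebra ℂ V) M] [IsScalarTower ℂ (SymmetricAlgebra ℂ V) M]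
    [IsScalarTower ℂ (SymmetricAlgebra ℂ V)ᵐᵒᵖ M] (f : V →ₗ[ℂ] M) :
    Derivation ℂ (SymmetricAlgebra ℂ V) M :=
  let F : SymmetricAlgebra ℂ V →ₐ[ℂ] TrivSqZeroExt (SymmetricAlgebra ℂ V) M :=
    SymmetricAlgebra.lift
      ((TrivSqZeroExt.inlAlgHom ℂ (SymmetricAlgebra ℂ V) M).toLinearMap ∘ₗ SymmetricAlgebra.ι ℂ V
        + (TrivSqZeroExt.inrHom (SymmetricAlgebra ℂ V) M).restrictScalars ℂ ∘ₗ f)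
  have hF : ∀ a, (F a).fst = a := fun a => by
    have h : (TrivSqZeroExt.fstHom ℂ (SymmetricAlgebra ℂ V) M).comp F = AlgHom.id ℂ _ := by
      apply SymmetricAlgebra.algHom_ext
      ext v
      simp [F]
    exact DFunLike.congr_fun h a
  Derivation.mk'
    ((TrivSqZeroExt.sndHom (SymmetricAlgebra ℂ V) M).restrictScalars ℂ ∘ₗ F.toLinearMap)
    (fun a b => by simp [hF, op_smul_eq_smul])

theorem symDerivation_ι {V M : Type*} [AddCommGroup V] [Module ℂ V] [AddCommGroup M]
    [Module ℂ M] [Module (SymmetricAlgebra ℂ V) M] [Module (SymmetricAlgebra ℂ V)ᵐᵒᵖ M]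
    [IsCentralScalar (SymmetricAlgebra ℂ V) M] [IsScalarTower ℂ (SymmetricAlgebra ℂ V) M]
    [IsScalarTower ℂ (SymmetricAlgebra ℂ V)ᵐᵒᵖ M] (f : V →ₗ[ℂ] M) (v : V) :
    symDerivation f (SymmetricAlgebra.ι ℂ V v) = f v := by
  simp [symDerivation]

theorem symDerivation_ext {V M : Type*} [AddCommGroup V] [Module ℂ V] [AddCommGroup M]
    [Module ℂ M] [Module (SymmetricAlgebra ℂ V) M]
    {D₁ D₂ : Derivation ℂ (SymmetricAlgebra ℂ V) M}
    (h : ∀ v, D₁ (SymmetricAlgebra.ι ℂ V v) = D₂ (SymmetricAlgebra.ι ℂ V v)) : D₁ = D₂ := by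
  ext a
  induction a using SymmetricAlgebra.induction with
  | algebraMap r => simp
  | ι x => exact h x
  | mul a b ha hb => simp [ha, hb]
  | add a b ha hb => simp [ha, hb]

variable (L : Type*) [LieRing L] [LieAlgebra ℂ L]

/-- The Poisson bracket of `S(L)` as a derivation of the first argument with values in
derivations of the second argument: the unique biderivation that extends `(x, y) ↦ [x, y]`. -/
def poissonBiderivation :
    Derivation ℂ (SymmetricAlgebra ℂ L)
      (Derivation ℂ (SymmetricAlgebra ℂ L) (SymmetricAlgebra ℂ L)) :=
  symDerivation
    { toFun := fun x => symDerivation (SymmetricAlgebra.ι ℂ L ∘ₗ LieAlgebra.ad ℂ L x)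
      map_add' := fun x y => symDerivation_ext fun v => by simp [symDerivation_ι]
      map_smul' := fun c x => symDerivation_ext fun v => by simp [symDerivation_ι] }

variable {L}

/-- The Poisson bracket `{f, g}` of the symmetric algebra `S(L)`. -/
def poissonBracket (f g : SymmetricAlgebra ℂ L) : SymmetricAlgebra ℂ L :=
  poissonBiderivation L f g

theorem poissonBracket_ι (x y : L) :
    poissonBracket (SymmetricAlgebra.ι ℂ L x) (SymmetricAlgebra.ι ℂ L y)
      = SymmetricAlgebra.ι ℂ L ⁅x, y⁆ := by
  simp [poissonBracket, poissonBiderivation, symDerivation_ι]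

/-- An ideal `I` of `S(L)` is Poisson if `{S(L), I} ⊆ I`. -/
def IsPoissonIdeal (I : Ideal (SymmetricAlgebra ℂ L)) : Prop :=
  ∀ f : SymmetricAlgebra ℂ L, ∀ g ∈ I, poissonBracket f g ∈ I

end Poisson

/-! ## Linear forms as points, the ideals `I(lam)`, and the `S(V)`-Zariski topology -/

section Points

variable {V : Type*} [AddCommGroup V] [Module ℂ V]

/-- The evaluation homomorphism `S(V) → ℂ`, `f ↦ f(lam)`, at a linear form `lam`. -/
def evalAt (lam : Module.Dual ℂ V) : SymmetricAlgebra ℂ V →ₐ[ℂ] ℂ :=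
  SymmetricAlgebra.lift lam

/-- The maximal ideal of all elements of `S(V)` that vanish at `lam`. -/
def idealAt (lam : Module.Dual ℂ V) : Ideal (SymmetricAlgebra ℂ V) :=
  RingHom.ker (evalAt lam)

theorem idealAt_isMaximal (lam : Module.Dual ℂ V) : (idealAt lam).IsMaximal :=
  RingHom.ker_isMaximal_of_surjective _ fun c =>
    ⟨algebraMap ℂ _ c, by simp⟩

/-- The set of common zeros in `V*` of a subset of `S(V)`. -/
def commonZeros (S : Set (SymmetricAlgebra ℂ V)) : Set (Module.Dual ℂ V) :=
  {lam | ∀ f ∈ S, evalAt lam f = 0}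

variable (V) in
/-- The `S(V)`-Zariski topology on `V*`: the topology induced from the Zariski topology of the
maximal spectrum of `S(V)` along `lam ↦ idealAt lam`. -/
@[reducible] def symZariski : TopologicalSpace (Module.Dual ℂ V) :=
  TopologicalSpace.induced
    (fun lam => (⟨idealAt lam, idealAt_isMaximal lam⟩ : MaximalSpectrum (SymmetricAlgebra ℂ V)))
    MaximalSpectrum.zariskiTopology

theorem isClosed_symZariski_iff (Z : Set (Module.Dual ℂ V)) :
    IsClosed[symZariski V] Z ↔ ∃ S : Set (SymmetricAlgebra ℂ V), Z = commonZeros S := by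
  have key : ∀ (S : Set (SymmetricAlgebra ℂ V)) (lam : Module.Dual ℂ V),
      S ⊆ idealAt lam ↔ lam ∈ commonZeros S := fun S lam => Iff.rfl
  unfold symZariski MaximalSpectrum.zariskiTopology
  rw [induced_compose, isClosed_induced_iff]
  constructor
  · rintro ⟨t, ht, rfl⟩
    obtain ⟨S, rfl⟩ := (PrimeSpectrum.isClosed_iff_zeroLocus t).1 ht
    exact ⟨S, rfl⟩
  · rintro ⟨S, rfl⟩
    exact ⟨PrimeSpectrum.zeroLocus S, PrimeSpectrum.isClosed_zeroLocus S, rfl⟩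

variable {L : Type*} [LieRing L] [LieAlgebra ℂ L]

/-- `I(lam)`, the largest Poisson ideal of `S(L)` contained in `idealAt lam`. -/
def poissonCore (lam : Module.Dual ℂ L) : Ideal (SymmetricAlgebra ℂ L) :=
  sSup {I | IsPoissonIdeal I ∧ I ≤ idealAt lam}

theorem poissonCore_isGreatest (lam : Module.Dual ℂ L) :
    IsGreatest {I : Ideal (SymmetricAlgebra ℂ L) | IsPoissonIdeal I ∧ I ≤ idealAt lam}
      (poissonCore lam) := by
  refine ⟨⟨fun f g hg => ?_, sSup_le fun I hI => hI.2⟩, fun I hI => le_sSup hI⟩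
  unfold poissonCore at hg ⊢
  rw [sSup_eq_iSup'] at hg ⊢
  induction hg using Submodule.iSup_induction' with
  | mem I x hx => exact Submodule.mem_iSup_of_mem I (I.2.1 f x hx)
  | zero => simp [poissonBracket]
  | add x y _ _ hx hy =>
    have : poissonBracket f (x + y) = poissonBracket f x + poissonBracket f y := by
      simp [poissonBracket]
    rw [this]
    exact add_mem hx hy

end Points

/-! ## Socle Lie algebras and the group `N̂` -/

/-- An exhaustion of a complex Lie algebra by an increasing sequence of finite-dimensional
nilpotent ideals. A Lie algebra is socle if it has such an exhaustion. -/
structure SocleExhaustion (L : Type*) [LieRing L] [LieAlgebra ℂ L] where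
  /-- The ideals of the exhaustion. -/
  ideal : ℕ → LieIdeal ℂ L
  mono : Monotone ideal
  finite : ∀ k, FiniteDimensional ℂ (ideal k)
  nilpotent : ∀ k, LieRing.IsNilpotent (ideal k)
  exhausts : ∀ x : L, ∃ k, x ∈ ideal k

/-- The exponential `∑ aⁱ / i!` of a nilpotent endomorphism. -/
def nilpotentExp {V : Type*} [AddCommGroup V] [Module ℂ V] (a : Module.End ℂ V) :
    Module.End ℂ V :=
  ∑ i ∈ Finset.range (nilpotencyClass a), ((i.factorial : ℂ)⁻¹) • a ^ i

namespace SocleExhaustion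

variable {L : Type*} [LieRing L] [LieAlgebra ℂ L] (E : SocleExhaustion L)

/-- The dual space of the `k`-th ideal. -/
abbrev DualAt (k : ℕ) : Type _ := Module.Dual ℂ (E.ideal k)

/-- Restriction of linear forms from the `m`-th ideal to the `k`-th one, `k ≤ m`. -/
def res {k m : ℕ} (h : k ≤ m) : E.DualAt m →ₗ[ℂ] E.DualAt k :=
  (Submodule.inclusion (E.mono h : (E.ideal k).toSubmodule ≤ (E.ideal m).toSubmodule)).dualMap

/-- Restriction of linear forms from the whole Lie algebra to the `k`-th ideal. -/
def resTop (k : ℕ) : Module.Dual ℂ L →ₗ[ℂ] E.DualAt k :=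
  (E.ideal k).toSubmodule.subtype.dualMap

theorem res_apply {k m : ℕ} (h : k ≤ m) (φ : E.DualAt m) (y : L) (hy : y ∈ E.ideal k) :
    E.res h φ ⟨y, hy⟩ = φ ⟨y, E.mono h hy⟩ := rfl

theorem resTop_apply (k : ℕ) (φ : Module.Dual ℂ L) (y : E.ideal k) :
    E.resTop k φ y = φ y := rfl

theorem res_resTop {k m : ℕ} (h : k ≤ m) (φ : Module.Dual ℂ L) :
    E.res h (E.resTop m φ) = E.resTop k φ := rfl

/-- The image in `GL(n_k*)` of the unipotent group `N_l = Exp n_l` under the coadjoint action on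
`n_k*`. Since `N_l` consists of the exponentials of the elements of `n_l`, its image is
generated by the operators `φ ↦ φ ∘ exp(-ad x)`, `x ∈ n_l`. -/
def coadImage (k l : ℕ) : Subgroup (E.DualAt k ≃ₗ[ℂ] E.DualAt k) :=
  Subgroup.closure {g | ∃ x ∈ E.ideal l, ∀ φ : E.DualAt k,
    g φ = φ ∘ₗ nilpotentExp (-(LieModule.toEnd ℂ L (E.ideal k) x))}

theorem coadImage_mono (k : ℕ) : Monotone (E.coadImage k) := fun _ _ h =>
  Subgroup.closure_mono fun _ ⟨x, hx, hg⟩ => ⟨x, E.mono h hx, hg⟩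

/-- The group `N̂_k`, the union of the images of `N_l` in `GL(n_k*)` over all `l ≥ k`. -/
def groupAt (k : ℕ) : Subgroup (E.DualAt k ≃ₗ[ℂ] E.DualAt k) where
  carrier := ⋃ l ≥ k, (E.coadImage k l : Set (E.DualAt k ≃ₗ[ℂ] E.DualAt k))
  mul_mem' := by
    simp only [Set.mem_iUnion, SetLike.mem_coe]
    rintro a b ⟨l, hl, ha⟩ ⟨m, _, hb⟩
    exact ⟨max l m, le_max_of_le_left hl, mul_mem (E.coadImage_mono k (le_max_left l m) ha)
      (E.coadImage_mono k (le_max_right l m) hb)⟩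
  one_mem' := by
    simp only [Set.mem_iUnion, SetLike.mem_coe]
    exact ⟨k, le_rfl, one_mem _⟩
  inv_mem' := by
    simp only [Set.mem_iUnion, SetLike.mem_coe]
    rintro a ⟨l, hl, ha⟩
    exact ⟨l, hl, inv_mem ha⟩

/-- The group `N̂`, the projective limit of the groups `N̂_k`: families `(g_k)` with `g_k ∈ N̂_k`
such that for `k ≤ m` the operator `g_m` induces `g_k` along the restriction `n_m* → n_k*`. -/
def proGroup : Subgroup (∀ k, E.DualAt k ≃ₗ[ℂ] E.DualAt k) where
  carrier := {g | (∀ k, g k ∈ E.groupAt k) ∧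
    ∀ (k m : ℕ) (h : k ≤ m) (φ : E.DualAt m), E.res h (g m φ) = g k (E.res h φ)}
  mul_mem' := by
    rintro a b ⟨ha, ha'⟩ ⟨hb, hb'⟩
    exact ⟨fun k => mul_mem (ha k) (hb k), fun k m h φ => by
      simp [LinearEquiv.mul_apply, ha', hb']⟩
  one_mem' := ⟨fun k => one_mem _, fun k m h φ => rfl⟩
  inv_mem' := by
    rintro a ⟨ha, ha'⟩
    refine ⟨fun k => inv_mem (ha k), fun k m h φ => ?_⟩
    apply (a k).injective
    have h1 : a m ((a m)⁻¹ φ) = φ := (a m).apply_symm_apply φ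
    have h2 : a k ((a k)⁻¹ (E.res h φ)) = E.res h φ := (a k).apply_symm_apply _
    rw [Pi.inv_apply, Pi.inv_apply, ← ha' k m h, h1, h2]

/-- The linear form on `L` obtained by gluing a compatible family of linear forms on the ideals
of the exhaustion. -/
def glue (μ : ∀ k, E.DualAt k) (hμ : ∀ (k m : ℕ) (h : k ≤ m), E.res h (μ m) = μ k) :
    Module.Dual ℂ L :=
  have key : ∀ (y : L) (k m : ℕ) (hk : y ∈ E.ideal k) (hm : y ∈ E.ideal m),
      μ k ⟨y, hk⟩ = μ m ⟨y, hm⟩ := by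
    intro y k m hk hm
    rcases le_total k m with h | h
    · rw [← hμ k m h, res_apply]
    · rw [← hμ m k h, res_apply]
  { toFun := fun y => μ (E.exhausts y).choose ⟨y, (E.exhausts y).choose_spec⟩
    map_add' := fun y z => by
      obtain ⟨i, hi⟩ := E.exhausts y
      obtain ⟨j, hj⟩ := E.exhausts z
      have hy := E.mono (le_max_left i j) hi
      have hz := E.mono (le_max_right i j) hj
      rw [key _ _ (max i j) _ (add_mem hy hz), key y _ (max i j) _ hy, key z _ (max i j) _ hz,
        ← map_add]
      rfl
    map_smul' := fun c y => by
      obtain ⟨i, hi⟩ := E.exhausts y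
      rw [key _ _ i _ ((E.ideal i).smul_mem c hi), key y _ i _ hi, RingHom.id_apply, ← map_smul]
      rfl }

theorem resTop_glue (μ : ∀ k, E.DualAt k)
    (hμ : ∀ (k m : ℕ) (h : k ≤ m), E.res h (μ m) = μ k) (k : ℕ) :
    E.resTop k (E.glue μ hμ) = μ k := by
  ext ⟨y, hy⟩
  change μ (E.exhausts y).choose ⟨y, (E.exhausts y).choose_spec⟩ = μ k ⟨y, hy⟩
  rcases le_total k (E.exhausts y).choose with h | h
  · rw [← hμ _ _ h, res_apply]
  · rw [← hμ _ _ h, res_apply]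

theorem ext_resTop {φ ψ : Module.Dual ℂ L} (h : ∀ k, E.resTop k φ = E.resTop k ψ) : φ = ψ := by
  ext y
  obtain ⟨k, hk⟩ := E.exhausts y
  exact DFunLike.congr_fun (h k) ⟨y, hk⟩

/-- The result `g.lam` of the coadjoint action of `g = (g_k) ∈ N̂` on `lam ∈ n*`: the linear form
whose restriction to `n_k` is `g_k` applied to the restriction of `lam`. -/
def coad (g : E.proGroup) (lam : Module.Dual ℂ L) : Module.Dual ℂ L :=
  E.glue (fun k => g.1 k (E.resTop k lam)) fun k m h => by rw [g.2.2 k m h, res_resTop]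

theorem resTop_coad (g : E.proGroup) (lam : Module.Dual ℂ L) (k : ℕ) :
    E.resTop k (E.coad g lam) = g.1 k (E.resTop k lam) :=
  E.resTop_glue _ _ k

/-- The coadjoint action of `N̂` on `n*`. -/
instance : MulAction E.proGroup (Module.Dual ℂ L) where
  smul := E.coad
  one_smul lam := E.ext_resTop fun k => E.resTop_coad 1 lam k
  mul_smul g h lam := E.ext_resTop fun k => by
    change E.resTop k (E.coad (g * h) lam) = E.resTop k (E.coad g (E.coad h lam))
    rw [resTop_coad, resTop_coad, resTop_coad]
    rfl

/-- A set of linear forms on `L` is a pro-subvariety of `n* = lim n_k*` if it is the projective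
limit of Zariski closed subsets `X_k ⊆ n_k*` along restriction maps `X_m → X_k` (`k ≤ m`) that
are dominant. -/
def IsProSubvariety (Z : Set (Module.Dual ℂ L)) : Prop :=
  ∃ X : ∀ k, Set (E.DualAt k),
    (∀ k, IsClosed[symZariski (E.ideal k)] (X k)) ∧
    (∀ (k m : ℕ) (h : k ≤ m), @closure _ (symZariski (E.ideal k)) (E.res h '' X m) = X k) ∧
    Z = {lam | ∀ k, E.resTop k lam ∈ X k}

end SocleExhaustion

end

/-! ### Exponentials of nilpotent endomorphisms. -/

section NilpotentExp

variable {V : Type*} [AddCommGroup V] [Module ℂ V]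

/-! Choose a flag `W 0 ⊆ W 1 ⊆ ...` of subspaces through all ideals of the exhaustion, with `W (i +
1)` spanned by `W i` and `w i`, and with `⁅x, w i⁆ ∈ W i` for all `x`. For fixed `φ`, look at the
stabilizer of `φ` restricted to `W i`. Either it contains some `y i` with `φ ⁅y i, w i⁆ = -1`, and
then `exp (t • y i)` keeps `φ` on `W i` and adds `t` to its value at `w i`; or the step is rigid and
the value at `w i` cannot be adjusted this way. Given a target `μ`, multiply such exponentials step
by step, each time with the parameter that corrects the current discrepancy (`defect`). If the
defect is zero at every rigid step, the partial products carry `φ` to `μ` on longer and longer parts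
of the flag.

Three facts turn this into a description of the orbit as the common zero set of the rigid defects
(`mem_orbit_iff`). The movers can be chosen to act trivially on each ideal from some index on,
because the images of the decreasing stabilizers in a finite-dimensional endomorphism algebra
stabilize (`exists_isMover`); hence the infinite product converges in `N̂`. Rigid defects vanish on
the orbit because their derivative along every curve `exp (t • x)` is zero (`defect_smul_eq_zero`).
Each component of an element of `N̂` agrees with that of a finite product of exponentials, which
suffices as each defect sees only one ideal.

Defects are polynomial (`defect_mem_polyFun`), so the orbit and all its restrictions to the ideals
are closed. For the Poisson part, the derivative of `f` along `exp (t • x) • μ` is minus the value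
of `{x, f}`. So a Poisson ideal vanishing at `φ` vanishes on its orbit, and the ideal of the orbit
is Poisson, hence lies in `I(φ)`; closedness of the orbit gives equality of zero sets. -/

theorem nilpotentExp_eq_sum {a : Module.End ℂ V} {N : ℕ} (h : a ^ N = 0) :
    nilpotentExp a = ∑ i ∈ Finset.range N, ((i.factorial : ℂ)⁻¹) • a ^ i := by
  have h₁ := Finset.sum_range_add_sum_Ico (fun i => ((i.factorial : ℂ)⁻¹) • a ^ i)
    (csInf_le' h : nilpotencyClass a ≤ N)
  rw [← h₁]
  refine left_eq_add.2 ?_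
  exact Finset.sum_eq_zero fun i hi => by
    rw [pow_eq_zero_of_le (Finset.mem_Ico.1 hi).1 (pow_nilpotencyClass ⟨N, h⟩), smul_zero]

theorem nilpotentExp_zero : nilpotentExp (0 : Module.End ℂ V) = 1 := by
  rw [nilpotentExp_eq_sum (N := 1) (by simp)]
  simp

/-- Complex vector spaces are rational ones, compatibly with the complex structure. -/
theorem exists_module_rat (V : Type*) [AddCommGroup V] [Module ℂ V] :
    ∃ _ : Module ℚ V, ∀ (q : ℚ) (v : V), q • v = (q : ℂ) • v :=
  ⟨Module.compHom V (algebraMap ℚ ℂ), fun _ _ => rfl⟩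

theorem isNilpotentExp_eq [Module ℚ V] (h : ∀ (q : ℚ) (v : V), q • v = (q : ℂ) • v)
    (a : Module.End ℂ V) : IsNilpotent.exp a = nilpotentExp a := by
  ext v
  simp [IsNilpotent.exp, nilpotentExp, h]

theorem nilpotentExp_mul_neg {a : Module.End ℂ V} (ha : IsNilpotent a) :
    nilpotentExp a * nilpotentExp (-a) = 1 := by
  obtain ⟨_, h⟩ := exists_module_rat V
  rw [← isNilpotentExp_eq h, ← isNilpotentExp_eq h, IsNilpotent.exp_mul_exp_neg_self ha]

theorem nilpotentExp_intertwines {V' : Type*} [AddCommGroup V'] [Module ℂ V']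
    {a : Module.End ℂ V} {b : Module.End ℂ V'} (ha : IsNilpotent a) (hb : IsNilpotent b)
    (f : V →ₗ[ℂ] V') (h : ∀ v, b (f v) = f (a v)) (v : V) :
    nilpotentExp b (f v) = f (nilpotentExp a v) := by
  obtain ⟨_, h₁⟩ := exists_module_rat V
  obtain ⟨_, h₂⟩ := exists_module_rat V'
  rw [← isNilpotentExp_eq h₁, ← isNilpotentExp_eq h₂]
  exact LinearMap.congr_fun
    (Module.End.commute_exp_left_of_commute ha hb (LinearMap.ext h)) v

theorem nilpotentExp_lie {K : Type*} [LieRing K] [LieAlgebra ℂ K] {a : Module.End ℂ K}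
    (ha : IsNilpotent a) (hd : ∀ x y, a ⁅x, y⁆ = ⁅x, a y⁆ + ⁅a x, y⁆) (x y : K) :
    nilpotentExp a ⁅x, y⁆ = ⁅nilpotentExp a x, nilpotentExp a y⁆ := by
  obtain ⟨_, h⟩ := exists_module_rat K
  rw [← isNilpotentExp_eq h]
  -- The bracket is viewed as a nonassociative product, so that the exponential of a derivation is
  -- multiplicative for it.
  let _i := LieRing.toNonUnitalNonAssocRing K
  have : SMulCommClass ℂ K K := LieAlgebra.smulCommClass ℂ K
  have : IsScalarTower ℂ K K := LieAlgebra.isScalarTower ℂ K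
  exact Module.End.exp_mul_of_derivation ℂ K a hd ha x y

end NilpotentExp

/-! ### Exponentials in `N̂` and the infinitesimal coadjoint action. -/

namespace SocleExhaustion

variable {L : Type*} [LieRing L] [LieAlgebra ℂ L] (E : SocleExhaustion L)

/-- The operator `-ad x` on the `k`-th ideal. -/
abbrev negAd (k : ℕ) (x : L) : Module.End ℂ (E.ideal k) :=
  -(LieModule.toEnd ℂ L (E.ideal k) x)

/-- Some larger ideal contains both `x` and the `k`-th one, and `x` is ad-nilpotent in that
nilpotent Lie algebra. -/
theorem isNilpotent_toEnd (k : ℕ) (x : L) :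
    IsNilpotent (LieModule.toEnd ℂ L (E.ideal k) x) := by
  obtain ⟨l, hl⟩ := E.exhausts x
  have hkm := E.mono (le_max_left k l)
  have hx := E.mono (le_max_right k l) hl
  have := E.nilpotent (max k l)
  obtain ⟨N, hN⟩ := LieModule.isNilpotent_toEnd_of_isNilpotent ℂ (E.ideal (max k l))
    (E.ideal (max k l)) ⟨x, hx⟩
  refine ⟨N, ?_⟩
  have key : ∀ (n : ℕ) (v : E.ideal k),
      (((LieModule.toEnd ℂ L (E.ideal k) x) ^ n) v : L)
        = ((LieModule.toEnd ℂ (E.ideal (max k l)) (E.ideal (max k l)) ⟨x, hx⟩) ^ n)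
            ⟨v, hkm v.2⟩ := by
    intro n v
    induction n with
    | zero => simp
    | succ n ih =>
      rw [pow_succ', pow_succ', Module.End.mul_apply, Module.End.mul_apply]
      simp only [LieModule.toEnd_apply_apply, LieSubmodule.coe_bracket, ih]
      rfl
  ext v
  rw [key, hN]
  simp

theorem isNilpotent_negAd (k : ℕ) (x : L) : IsNilpotent (E.negAd k x) :=
  (E.isNilpotent_toEnd k x).neg

theorem negAd_neg (k : ℕ) (x : L) : E.negAd k (-x) = -E.negAd k x := by
  simp [negAd]

/-- The operator `φ ↦ φ ∘ exp(-ad x)` on the dual space of the `k`-th ideal. -/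
noncomputable def expAt (k : ℕ) (x : L) : E.DualAt k ≃ₗ[ℂ] E.DualAt k :=
  LinearEquiv.ofLinearMap (nilpotentExp (E.negAd k x)).dualMap
    (nilpotentExp (E.negAd k (-x))).dualMap
    (by
      have h := nilpotentExp_mul_neg (E.isNilpotent_negAd k (-x))
      rw [← negAd_neg, neg_neg] at h
      exact LinearMap.ext fun φ => LinearMap.ext fun v =>
        congrArg φ (LinearMap.congr_fun h v))
    (by
      have h := nilpotentExp_mul_neg (E.isNilpotent_negAd k x)
      rw [← negAd_neg] at h
      exact LinearMap.ext fun φ => LinearMap.ext fun v =>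
        congrArg φ (LinearMap.congr_fun h v))

theorem eq_expAt_iff (k : ℕ) (x : L) (g : E.DualAt k ≃ₗ[ℂ] E.DualAt k) :
    (∀ φ : E.DualAt k, g φ = φ ∘ₗ nilpotentExp (-(LieModule.toEnd ℂ L (E.ideal k) x)))
      ↔ g = E.expAt k x :=
  ⟨fun h => LinearEquiv.ext h, fun h _ => h ▸ rfl⟩

theorem nilpotentExp_inclusion {k m : ℕ} (h : k ≤ m) (x : L) (v : E.ideal k) :
    (nilpotentExp (E.negAd m x) ⟨v, E.mono h v.2⟩ : L) = nilpotentExp (E.negAd k x) v :=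
  congrArg Subtype.val (nilpotentExp_intertwines (E.isNilpotent_negAd k x)
    (E.isNilpotent_negAd m x) (Submodule.inclusion (E.mono h : (E.ideal k).toSubmodule ≤ _))
    (fun _ => rfl) v)

/-- The element `exp x` of the group `N̂`, for `x ∈ n`. -/
noncomputable def exp (x : L) : E.proGroup :=
  ⟨fun k => E.expAt k x, fun k => by
    obtain ⟨l, hl⟩ := E.exhausts x
    change _ ∈ ⋃ l ≥ k, (E.coadImage k l : Set (E.DualAt k ≃ₗ[ℂ] E.DualAt k))
    simp only [Set.mem_iUnion]
    exact ⟨max k l, le_max_left _ _,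
      Subgroup.subset_closure ⟨x, E.mono (le_max_right _ _) hl, fun _ => rfl⟩⟩, fun k m h φ => by
    ext v
    change φ (nilpotentExp (E.negAd m x) ⟨v, E.mono h v.2⟩)
      = φ ⟨nilpotentExp (E.negAd k x) v, E.mono h (nilpotentExp (E.negAd k x) v).2⟩
    exact congrArg φ (Subtype.ext (E.nilpotentExp_inclusion h x v))⟩

theorem resTop_smul (g : E.proGroup) (μ : Module.Dual ℂ L) (k : ℕ) :
    E.resTop k (g • μ) = g.1 k (E.resTop k μ) :=
  E.resTop_coad g μ k

theorem smul_apply (g : E.proGroup) (μ : Module.Dual ℂ L) {k : ℕ} (v : E.ideal k) :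
    (g • μ) v = g.1 k (E.resTop k μ) v := by
  rw [← E.resTop_smul, resTop_apply]

theorem exp_smul_apply (x : L) (μ : Module.Dual ℂ L) {k : ℕ} (v : E.ideal k) :
    (E.exp x • μ) v = μ (nilpotentExp (E.negAd k x) v : E.ideal k) :=
  E.smul_apply (E.exp x) μ v

theorem exp_zero : E.exp 0 = 1 := by
  refine Subtype.ext (funext fun k => LinearEquiv.ext fun φ => LinearMap.ext fun v => ?_)
  change φ (nilpotentExp (E.negAd k 0) v) = φ v
  simp [negAd, nilpotentExp_zero]

theorem exp_inv (x : L) : (E.exp x)⁻¹ = E.exp (-x) := by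
  refine inv_eq_of_mul_eq_one_right
    (Subtype.ext (funext fun k => LinearEquiv.ext fun φ => LinearMap.ext fun v => ?_))
  have h := nilpotentExp_mul_neg (E.isNilpotent_negAd k (-x))
  rw [← negAd_neg, neg_neg] at h
  exact congrArg φ (LinearMap.congr_fun h v)

theorem exp_val_eq_one {x : L} {k : ℕ} (h : ∀ v ∈ E.ideal k, ⁅x, v⁆ = 0) :
    (E.exp x).1 k = 1 := by
  have h0 : E.negAd k x = 0 := by
    ext v
    simp [h v v.2]
  refine LinearEquiv.ext fun φ => LinearMap.ext fun v => ?_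
  change φ (nilpotentExp (E.negAd k x) v) = φ v
  rw [h0, nilpotentExp_zero, Module.End.one_apply]

theorem smul_add_apply (g : E.proGroup) (μ ν : Module.Dual ℂ L) : g • (μ + ν) = g • μ + g • ν :=
  E.ext_resTop fun k => by rw [resTop_smul]; simp [resTop_smul]

theorem smul_smul_apply (g : E.proGroup) (c : ℂ) (μ : Module.Dual ℂ L) : g • (c • μ) = c • g • μ :=
  E.ext_resTop fun k => by rw [resTop_smul]; simp [resTop_smul]

/-- The coadjoint action of `N̂` on `n*` is additive. -/
@[reducible] noncomputable def distribMulAction :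
    DistribMulAction E.proGroup (Module.Dual ℂ L) where
  smul_zero g := by simpa using E.smul_smul_apply g 0 0
  smul_add := E.smul_add_apply

theorem smulCommClass : SMulCommClass E.proGroup ℂ (Module.Dual ℂ L) := ⟨E.smul_smul_apply⟩

/-- The coadjoint action of `n` on `n*`. -/
def coadj (x : L) (μ : Module.Dual ℂ L) : Module.Dual ℂ L :=
  -(μ ∘ₗ LieAlgebra.ad ℂ L x)

omit E in
theorem coadj_apply (x : L) (μ : Module.Dual ℂ L) (v : L) : coadj x μ v = -μ ⁅x, v⁆ := rfl

/-- `t ↦ exp(tx) μ` is a polynomial curve. -/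
theorem exists_polynomial_exp_smul (x : L) (μ : Module.Dual ℂ L) (v : L) :
    ∃ P : Polynomial ℂ, ∀ t : ℂ, (E.exp (t • x) • μ) v = P.eval t ∧
      (E.exp (t • x) • coadj x μ) v = (Polynomial.derivative P).eval t := by
  obtain ⟨k, hk⟩ := E.exhausts v
  obtain ⟨N, hN⟩ := E.isNilpotent_negAd k x
  -- One more term than needed: the zero top term is dropped on one side and the constant term on
  -- the other when the series is differentiated.
  have hN' (t : ℂ) : E.negAd k (t • x) ^ (N + 1) = 0 := by
    have : E.negAd k (t • x) = t • E.negAd k x := by simp [negAd]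
    rw [this, smul_pow, pow_succ (E.negAd k x), hN]; simp
  have hpow (t : ℂ) (i : ℕ) : E.negAd k (t • x) ^ i = t ^ i • E.negAd k x ^ i := by
    have : E.negAd k (t • x) = t • E.negAd k x := by simp [negAd]
    rw [this, smul_pow]
  have key (ψ : Module.Dual ℂ L) (t : ℂ) : (E.exp (t • x) • ψ) v
      = ∑ i ∈ Finset.range (N + 1), ((i.factorial : ℂ)⁻¹ * t ^ i)
        * ψ ((E.negAd k x ^ i) ⟨v, hk⟩ : E.ideal k) := by
    rw [E.exp_smul_apply (t • x) ψ (⟨v, hk⟩ : E.ideal k), nilpotentExp_eq_sum (hN' t)]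
    simp only [hpow, LinearMap.sum_apply, LinearMap.smul_apply, smul_smul]
    change ψ ((E.ideal k).subtype _) = _
    simp
  refine ⟨∑ i ∈ Finset.range (N + 1), Polynomial.C ((i.factorial : ℂ)⁻¹
    * μ ((E.negAd k x ^ i) ⟨v, hk⟩ : E.ideal k)) * Polynomial.X ^ i, fun t => ⟨?_, ?_⟩⟩
  · rw [key, Polynomial.eval_finsetSum]
    refine Finset.sum_congr rfl fun i _ => ?_
    simp; ring
  · rw [key, Polynomial.derivative_sum, Polynomial.eval_finsetSum, Finset.sum_range_succ,
      Finset.sum_range_succ', hN]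
    simp only [LinearMap.zero_apply, ZeroMemClass.coe_zero, map_zero, mul_zero, add_zero,
      Polynomial.derivative_C_mul_X_pow, pow_zero, Polynomial.eval_mul,
      Polynomial.eval_C, mul_one, Polynomial.derivative_C, Polynomial.eval_zero]
    refine Finset.sum_congr rfl fun i _ => ?_
    have h1 : coadj x μ ((E.negAd k x ^ i) ⟨v, hk⟩ : E.ideal k)
        = μ ((E.negAd k x ^ (i + 1)) ⟨v, hk⟩ : E.ideal k) := by
      rw [pow_succ', Module.End.mul_apply, coadj_apply, ← map_neg]
      rfl
    rw [h1]
    have : (i.factorial : ℂ) ≠ 0 := by exact_mod_cast i.factorial_ne_zero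
    have : (i : ℂ) + 1 ≠ 0 := by exact_mod_cast i.succ_ne_zero
    simp [Nat.factorial_succ]
    field_simp

theorem exp_smul_coadj (x : L) (μ : Module.Dual ℂ L) :
    E.exp x • coadj x μ = coadj x (E.exp x • μ) := by
  ext v
  obtain ⟨k, hk⟩ := E.exhausts v
  rw [coadj_apply, E.exp_smul_apply x _ (⟨v, hk⟩ : E.ideal k), coadj_apply,
    E.exp_smul_apply x _ (⟨⁅x, v⁆, lie_mem_right ℂ L _ x v hk⟩ : E.ideal k)]
  have h := nilpotentExp_intertwines (E.isNilpotent_negAd k x) (E.isNilpotent_negAd k x)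
    (LieModule.toEnd ℂ L (E.ideal k) x) (fun v => by simp) ⟨v, hk⟩
  exact congrArg (fun u : E.ideal k => -μ u) h.symm

theorem coadj_smul (c : ℂ) (x : L) (μ : Module.Dual ℂ L) : coadj (c • x) μ = c • coadj x μ := by
  ext v
  simp [coadj_apply]

/-- `exp y` normalizes the coadjoint action of `n`. -/
theorem exists_exp_smul_coadj (x y : L) : ∃ x' : L, ∀ ψ : Module.Dual ℂ L,
    E.exp y • coadj x' ψ = coadj x (E.exp y • ψ) := by
  obtain ⟨k, hk⟩ := E.exhausts x
  -- The witness is `exp(-ad y) x`; the identity holds because `exp(-ad y)` is a Lie algebra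
  -- automorphism.
  refine ⟨nilpotentExp (E.negAd k y) ⟨x, hk⟩, fun ψ => LinearMap.ext fun v => ?_⟩
  obtain ⟨l, hl⟩ := E.exhausts v
  have hx := E.mono (le_max_left k l) hk
  have hv := E.mono (le_max_right k l) hl
  rw [← E.nilpotentExp_inclusion (le_max_left k l) y ⟨x, hk⟩, coadj_apply,
    E.exp_smul_apply y _ (⟨v, hv⟩ : E.ideal (max k l)), coadj_apply,
    E.exp_smul_apply y _ (⟨⁅x, v⁆, lie_mem_right ℂ L _ x v hv⟩ : E.ideal (max k l))]
  have h := nilpotentExp_lie (E.isNilpotent_negAd (max k l) y) (fun a b => by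
    refine Subtype.ext ?_
    change -⁅y, ⁅(a : L), (b : L)⁆⁆ = ⁅(a : L), -⁅y, (b : L)⁆⁆ + ⁅-⁅y, (a : L)⁆, (b : L)⁆
    rw [leibniz_lie y (a : L) (b : L), lie_neg, neg_lie]
    abel) (⟨x, hx⟩ : E.ideal (max k l)) ⟨v, hv⟩
  exact congrArg (fun u : E.ideal (max k l) => -ψ u) h.symm

end SocleExhaustion

/-! ### Differentiation along one-parameter groups, and paths in `N̂`. -/

namespace SocleExhaustion

variable {L : Type*} [LieRing L] [LieAlgebra ℂ L] (E : SocleExhaustion L)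

attribute [local instance] distribMulAction smulCommClass

theorem exp_smul_smul_coadj (t : ℂ) (x : L) (μ : Module.Dual ℂ L) :
    E.exp (t • x) • coadj x μ = coadj x (E.exp (t • x) • μ) := by
  rcases eq_or_ne t 0 with rfl | ht
  · simp [exp_zero]
  · have h := E.exp_smul_coadj (t • x) μ
    rw [coadj_smul, coadj_smul, smul_comm] at h
    exact smul_right_injective _ ht h

theorem hasDerivAt_exp_smul (x : L) (μ : Module.Dual ℂ L) (v : L) (t : ℂ) :
    HasDerivAt (fun τ : ℂ => (E.exp (τ • x) • μ) v) ((E.exp (t • x) • coadj x μ) v) t := by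
  obtain ⟨P, hP⟩ := E.exists_polynomial_exp_smul x μ v
  rw [(hP t).2, funext fun τ => (hP τ).1]
  exact P.hasDerivAt t

/-- The derivative in `t` of the value at `v` is minus the value at `⁅x, v⁆`, here the constant `c`.
-/
theorem exp_smul_apply_of_const {x : L} {μ : Module.Dual ℂ L} {v : L} {c : ℂ}
    (h : ∀ t : ℂ, (E.exp (t • x) • μ) ⁅x, v⁆ = -c) (t : ℂ) :
    (E.exp (t • x) • μ) v = μ v + t * c := by
  have hd (τ : ℂ) : HasDerivAt (fun τ : ℂ => (E.exp (τ • x) • μ) v - τ * c) 0 τ := by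
    have h1 := (E.hasDerivAt_exp_smul x μ v τ).sub ((hasDerivAt_id τ).mul_const c)
    rw [exp_smul_smul_coadj, coadj_apply, h] at h1
    exact h1.congr_deriv (by simp)
  have h2 := is_const_of_deriv_eq_zero (fun τ => (hd τ).differentiableAt)
    (fun τ => (hd τ).deriv) t 0
  simp only [zero_smul, exp_zero, one_smul, zero_mul, sub_zero] at h2
  rw [← h2]; ring

/-- The group generated by the exponentials of the elements of `n`. -/
def expGroup : Subgroup E.proGroup := Subgroup.closure (Set.range E.exp)

theorem exp_mem_expGroup (x : L) : E.exp x ∈ E.expGroup :=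
  Subgroup.subset_closure ⟨x, rfl⟩

theorem expGroup_induction {p : E.proGroup → Prop} (one : p 1)
    (exp_mul : ∀ x, ∀ g ∈ E.expGroup, p g → p (E.exp x * g)) : ∀ g ∈ E.expGroup, p g := by
  intro g hg
  induction hg using Subgroup.closure_induction_left with
  | one => exact one
  | mul_left x hx y hy ih => obtain ⟨x, rfl⟩ := hx; exact exp_mul x y hy ih
  | inv_mul_cancel x hx y hy ih =>
    obtain ⟨x, rfl⟩ := hx
    rw [exp_inv]
    exact exp_mul (-x) y hy ih

theorem exists_smul_coadj {g : E.proGroup} (hg : g ∈ E.expGroup) : ∀ x : L, ∃ x' : L,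
    ∀ ψ : Module.Dual ℂ L, g • coadj x' ψ = coadj x (g • ψ) := by
  refine E.expGroup_induction (p := fun g => ∀ x : L, ∃ x' : L,
    ∀ ψ : Module.Dual ℂ L, g • coadj x' ψ = coadj x (g • ψ)) (fun x => ⟨x, fun ψ => by simp⟩)
    (fun y g _ ih x => ?_) g hg
  obtain ⟨x₁, h₁⟩ := E.exists_exp_smul_coadj x y
  obtain ⟨x₂, h₂⟩ := ih x₁
  exact ⟨x₂, fun ψ => by rw [mul_smul, h₂, h₁, mul_smul]⟩

theorem smul_congr {k : ℕ} (g : E.proGroup) {ψ ψ' : Module.Dual ℂ L}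
    (h : ∀ v ∈ E.ideal k, ψ v = ψ' v) : ∀ v ∈ E.ideal k, (g • ψ) v = (g • ψ') v := by
  intro v hv
  have : E.resTop k ψ = E.resTop k ψ' := LinearMap.ext fun v => h v v.2
  rw [E.smul_apply g ψ (⟨v, hv⟩ : E.ideal k), E.smul_apply g ψ' (⟨v, hv⟩ : E.ideal k), this]

/-- Dual bases of the `k`-th ideal. -/
theorem exists_dual_bases (k : ℕ) : ∃ (n : ℕ) (b : Fin n → L) (β : Fin n → Module.Dual ℂ L),
    (∀ j, b j ∈ E.ideal k) ∧
    ∀ ψ : Module.Dual ℂ L, ∀ v ∈ E.ideal k, ψ v = (∑ j, ψ (b j) • β j) v := by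
  have := E.finite k
  let B := Module.finBasis ℂ (E.ideal k)
  choose β hβ using fun j => LinearMap.exists_extend (p := (E.ideal k).toSubmodule) (B.coord j)
  refine ⟨_, fun j => (B j : L), β, fun j => (B j).2, fun ψ v hv => ?_⟩
  have h1 (j) : β j v = B.repr ⟨v, hv⟩ j := LinearMap.congr_fun (hβ j) ⟨v, hv⟩
  have h2 := congrArg (E.resTop k ψ) (B.sum_repr ⟨v, hv⟩)
  rw [map_sum] at h2
  change _ = ψ v at h2
  rw [← h2]
  simp [h1, resTop_apply, mul_comm]

theorem smul_apply_eq_sum {k n : ℕ} {b : Fin n → L} {β : Fin n → Module.Dual ℂ L}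
    (h : ∀ ψ : Module.Dual ℂ L, ∀ v ∈ E.ideal k, ψ v = (∑ j, ψ (b j) • β j) v)
    (g : E.proGroup) (ψ : Module.Dual ℂ L) {v : L} (hv : v ∈ E.ideal k) :
    (g • ψ) v = ∑ j, ψ (b j) * (g • β j) v := by
  rw [E.smul_congr g (h ψ) v hv, Finset.smul_sum, LinearMap.sum_apply]
  exact Finset.sum_congr rfl fun j _ => by rw [smul_comm]; rfl

/-- Curves in `N̂` whose logarithmic derivative is a curve in `n`. -/
def IsPath (s : ℂ → E.proGroup) : Prop :=
  ∃ a : ℂ → L, ∀ (t : ℂ) (ψ : Module.Dual ℂ L) (v : L),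
    HasDerivAt (fun τ => (s τ • ψ) v) ((s t • coadj (a t) ψ) v) t

omit E in
theorem coadj_add (x y : L) (μ : Module.Dual ℂ L) : coadj (x + y) μ = coadj x μ + coadj y μ := by
  ext v
  simp only [coadj_apply, add_lie, map_add, LinearMap.add_apply]
  ring

omit E in
theorem coadj_sub (x y : L) (μ : Module.Dual ℂ L) : coadj (x - y) μ = coadj x μ - coadj y μ := by
  ext v
  simp only [coadj_apply, sub_lie, map_sub, LinearMap.sub_apply]
  ring

variable {E}

theorem isPath_one : E.IsPath fun _ => 1 :=
  ⟨fun _ => 0, fun t ψ v => by simpa [coadj_apply] using hasDerivAt_const t (ψ v)⟩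

theorem IsPath.mul_exp {s : ℂ → E.proGroup} (hs : E.IsPath s) {d d' : ℂ → ℂ}
    (hd : ∀ t, HasDerivAt d (d' t) t) (y : L) : E.IsPath fun t => s t * E.exp (d t • y) := by
  obtain ⟨a, ha⟩ := hs
  choose a' ha' using fun t => E.exists_smul_coadj (E.exp_mem_expGroup (d t • y)) (a t)
  -- Product rule for the left logarithmic derivative: `a' t` is `a t` conjugated past the factor
  -- `exp (d t • y)`. Dual bases of one ideal turn the composite into a finite sum of products of
  -- scalar functions.
  refine ⟨fun t => d' t • y + a' t, fun t ψ v => ?_⟩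
  obtain ⟨k, hk⟩ := E.exhausts v
  obtain ⟨n, b, β, hb, h⟩ := E.exists_dual_bases k
  have he (u : L) : HasDerivAt (fun τ => (E.exp (d τ • y) • ψ) u)
      ((E.exp (d t • y) • coadj (d' t • y) ψ) u) t := by
    have h1 := (E.hasDerivAt_exp_smul y ψ u (d t)).comp t (hd t)
    rw [coadj_smul, smul_comm, LinearMap.smul_apply, smul_eq_mul, mul_comm]
    exact h1
  simp only [mul_smul]
  rw [funext fun τ => E.smul_apply_eq_sum h (s τ) (E.exp (d τ • y) • ψ) hk]
  have h2 := HasDerivAt.fun_sum (u := Finset.univ) fun j _ => (he (b j)).mul (ha t (β j) v)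
  refine h2.congr_deriv ?_
  rw [coadj_add, smul_add, smul_add, ha', LinearMap.add_apply, Finset.sum_add_distrib,
    E.smul_apply_eq_sum h (s t) _ hk]
  congr 1
  have h3 : ∀ u ∈ E.ideal k, coadj (a t) (E.exp (d t • y) • ψ) u
      = coadj (a t) (∑ j, (E.exp (d t • y) • ψ) (b j) • β j) u := fun u hu => by
    rw [coadj_apply, coadj_apply, h _ _ (lie_mem_right ℂ L _ _ _ hu)]
  rw [E.smul_congr (s t) h3 v hk]
  have h4 : coadj (a t) (∑ j, (E.exp (d t • y) • ψ) (b j) • β j)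
      = ∑ j, (E.exp (d t • y) • ψ) (b j) • coadj (a t) (β j) := by
    ext u
    simp [coadj_apply]
  rw [h4, Finset.smul_sum, LinearMap.sum_apply]
  exact Finset.sum_congr rfl fun j _ => by rw [smul_comm]; rfl

/-! ### Invariant flags and their unipotence. -/

variable (E) in
/-- A flag of invariant subspaces of `n` with steps of dimension at most one, passing through all
ideals of the exhaustion; `W (i + 1)` is spanned by `W i` and `w i`. -/
structure IsFlag (W : ℕ → Submodule ℂ L) (w : ℕ → L) : Prop where
  zero : W 0 = ⊥
  succ : ∀ i, W (i + 1) = W i ⊔ Submodule.span ℂ {w i}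
  lie_mem : ∀ (x : L) (i : ℕ), ⁅x, w i⁆ ∈ W i
  exhausts : ∀ k, ∃ d, W d = (E.ideal k).toSubmodule

namespace IsFlag

variable {W : ℕ → Submodule ℂ L} {w : ℕ → L} (F : E.IsFlag W w)
include F

theorem mono : Monotone W :=
  monotone_nat_of_le_succ fun i => by rw [F.succ]; exact le_sup_left

theorem mem_succ_iff {i : ℕ} {v : L} : v ∈ W (i + 1) ↔ ∃ u ∈ W i, ∃ c : ℂ, u + c • w i = v := by
  rw [F.succ, Submodule.mem_sup]
  simp [Submodule.mem_span_singleton]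

theorem mem_succ_self (i : ℕ) : w i ∈ W (i + 1) :=
  F.mem_succ_iff.2 ⟨0, zero_mem _, 1, by simp⟩

theorem lie_mem_of_mem_succ (x : L) {i : ℕ} : ∀ {v : L}, v ∈ W (i + 1) → ⁅x, v⁆ ∈ W i := by
  induction i with
  | zero =>
    intro v hv
    obtain ⟨u, hu, c, rfl⟩ := F.mem_succ_iff.1 hv
    rw [F.zero, Submodule.mem_bot] at hu
    rw [hu, zero_add, lie_smul]
    exact Submodule.smul_mem _ _ (F.lie_mem x 0)
  | succ i ih =>
    intro v hv
    obtain ⟨u, hu, c, rfl⟩ := F.mem_succ_iff.1 hv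
    rw [lie_add, lie_smul]
    exact add_mem (F.mono i.le_succ (ih hu)) (Submodule.smul_mem _ _ (F.lie_mem x _))

theorem eq_on_succ {i : ℕ} {φ ψ : Module.Dual ℂ L} (h : ∀ u ∈ W i, φ u = ψ u)
    (hw : φ (w i) = ψ (w i)) : ∀ u ∈ W (i + 1), φ u = ψ u := by
  intro v hv
  obtain ⟨u, hu, c, rfl⟩ := F.mem_succ_iff.1 hv
  rw [map_add, map_add, map_smul, map_smul, h u hu, hw]

/-- Unipotence on the dual of the flag: the derivative at `v` involves only `⁅x, v⁆`, which lies one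
step lower, where `ψ` vanishes and, by induction, keeps vanishing. -/
theorem exp_smul_eq {i : ℕ} (x : L) {ψ : Module.Dual ℂ L} (h : ∀ u ∈ W i, ψ u = 0) (t : ℂ) :
    ∀ v ∈ W (i + 1), (E.exp (t • x) • ψ) v = ψ v := by
  induction i generalizing t with
  | zero =>
    intro v hv
    rw [E.exp_smul_apply_of_const (c := 0) (fun t => ?_), mul_zero, add_zero]
    have := F.lie_mem_of_mem_succ x hv
    rw [F.zero, Submodule.mem_bot] at this
    simp [this]
  | succ i ih =>
    intro v hv
    rw [E.exp_smul_apply_of_const (c := 0) (fun t => ?_), mul_zero, add_zero]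
    have hx := F.lie_mem_of_mem_succ x hv
    rw [ih (fun u hu => h u (F.mono i.le_succ hu)) t _ hx, h _ hx, neg_zero]

theorem smul_eq {i : ℕ} {g : E.proGroup} (hg : g ∈ E.expGroup) {ψ : Module.Dual ℂ L}
    (h : ∀ u ∈ W i, ψ u = 0) : ∀ v ∈ W (i + 1), (g • ψ) v = ψ v := by
  refine E.expGroup_induction (p := fun g => ∀ v ∈ W (i + 1), (g • ψ) v = ψ v) (by simp)
    (fun x g _ ih v hv => ?_) g hg
  have := F.exp_smul_eq x (ψ := g • ψ)
    (fun u hu => by rw [ih u (F.mono i.le_succ hu), h u hu]) 1 v hv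
  rw [mul_smul, ← ih v hv, ← this, one_smul]

/-- An infinitesimal stabilizer exponentiates to a stabilizer. Induction along the flag works
because the derivative at `u ∈ W (j + 1)` is governed by `⁅y, u⁆ ∈ W j`. -/
theorem exp_smul_eq_of_annihilates {i : ℕ} {y : L} {φ : Module.Dual ℂ L}
    (h : ∀ u ∈ W i, φ ⁅y, u⁆ = 0) (t : ℂ) : ∀ u ∈ W i, (E.exp (t • y) • φ) u = φ u := by
  suffices ∀ j ≤ i, ∀ t : ℂ, ∀ u ∈ W j, (E.exp (t • y) • φ) u = φ u from this i le_rfl t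
  intro j
  induction j with
  | zero =>
    intro _ t u hu
    rw [F.zero, Submodule.mem_bot] at hu
    simp [hu]
  | succ j ih =>
    intro hj t u hu
    rw [E.exp_smul_apply_of_const (c := 0) (fun t => ?_), mul_zero, add_zero]
    rw [ih (by omega) t _ (F.lie_mem_of_mem_succ y hu), h u (F.mono hj hu), neg_zero]

end IsFlag

/-- The stabilizer in `n` of the restriction of `φ` to `W i` also annihilates the restriction
of `φ` to `W (i + 1)`. -/
def IsRigid (W : ℕ → Submodule ℂ L) (w : ℕ → L) (φ : Module.Dual ℂ L) (i : ℕ) : Prop :=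
  ∀ x : L, (∀ u ∈ W i, φ ⁅x, u⁆ = 0) → φ ⁅x, w i⁆ = 0

variable (E) in
/-- Elements `y i` of the stabilizers of the restrictions of `φ` that move the value at `w i`
whenever this is possible, and that act eventually trivially on each ideal of the exhaustion. -/
structure IsMover (W : ℕ → Submodule ℂ L) (w : ℕ → L) (φ : Module.Dual ℂ L) (y : ℕ → L) :
    Prop where
  annihilates : ∀ i, ∀ u ∈ W i, φ ⁅y i, u⁆ = 0
  moves : ∀ i, ¬ IsRigid W w φ i → φ ⁅y i, w i⁆ = -1
  eq_zero : ∀ i, IsRigid W w φ i → y i = 0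
  eventually : ∀ k, ∃ N, ∀ i ≥ N, ∀ v ∈ E.ideal k, ⁅y i, v⁆ = 0

/-! ### Sections and defects. -/

variable (E) in
/-- The element of `N̂` that moves `φ` towards `μ` on the first `i` steps of a flag. -/
noncomputable def sec (w : ℕ → L) (φ : Module.Dual ℂ L) (y : ℕ → L) :
    ℕ → Module.Dual ℂ L → E.proGroup
  | 0, _ => 1
  | i + 1, μ => sec w φ y i μ * E.exp ((μ (w i) - (sec w φ y i μ • φ) (w i)) • y i)

variable (E) in
/-- The obstruction to moving `φ` to `μ` at the `i`-th step. -/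
noncomputable def defect (w : ℕ → L) (φ : Module.Dual ℂ L) (y : ℕ → L) (i : ℕ)
    (μ : Module.Dual ℂ L) : ℂ :=
  μ (w i) - (E.sec w φ y i μ • φ) (w i)

theorem sec_succ (w : ℕ → L) (φ : Module.Dual ℂ L) (y : ℕ → L) (i : ℕ) (μ : Module.Dual ℂ L) :
    E.sec w φ y (i + 1) μ = E.sec w φ y i μ * E.exp (E.defect w φ y i μ • y i) := rfl

theorem sec_mem_expGroup (w : ℕ → L) (φ : Module.Dual ℂ L) (y : ℕ → L) (i : ℕ)
    (μ : Module.Dual ℂ L) : E.sec w φ y i μ ∈ E.expGroup := by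
  induction i with
  | zero => exact one_mem _
  | succ i ih => exact mul_mem ih (E.exp_mem_expGroup _)

theorem sec_congr (w : ℕ → L) (φ : Module.Dual ℂ L) (y : ℕ → L) {i : ℕ} {μ ν : Module.Dual ℂ L}
    (h : ∀ j < i, μ (w j) = ν (w j)) : E.sec w φ y i μ = E.sec w φ y i ν := by
  induction i with
  | zero => rfl
  | succ i ih =>
    have := ih fun j hj => h j (by omega)
    rw [sec_succ, sec_succ, defect, defect, this, h i (by omega)]

theorem defect_congr (w : ℕ → L) (φ : Module.Dual ℂ L) (y : ℕ → L) {i : ℕ}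
    {μ ν : Module.Dual ℂ L} (h : ∀ j ≤ i, μ (w j) = ν (w j)) :
    E.defect w φ y i μ = E.defect w φ y i ν := by
  rw [defect, defect, sec_congr w φ y fun j hj => h j hj.le, h i le_rfl]

theorem exists_hasDerivAt_defect (w : ℕ → L) (φ : Module.Dual ℂ L) (y : ℕ → L) (x : L)
    (μ : Module.Dual ℂ L) (i : ℕ) (hs : E.IsPath fun t => E.sec w φ y i (E.exp (t • x) • μ))
    (t : ℂ) : ∃ d', HasDerivAt (fun t => E.defect w φ y i (E.exp (t • x) • μ)) d' t := by
  obtain ⟨a, ha⟩ := hs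
  exact ⟨_, (E.hasDerivAt_exp_smul x μ (w i) t).sub (ha t φ (w i))⟩

theorem isPath_sec (w : ℕ → L) (φ : Module.Dual ℂ L) (y : ℕ → L) (x : L)
    (μ : Module.Dual ℂ L) (i : ℕ) : E.IsPath fun t => E.sec w φ y i (E.exp (t • x) • μ) := by
  induction i with
  | zero => exact isPath_one
  | succ i ih =>
    choose d' hd' using exists_hasDerivAt_defect w φ y x μ i ih
    exact ih.mul_exp hd' (y i)

namespace IsFlag

variable {W : ℕ → Submodule ℂ L} {w : ℕ → L} (F : E.IsFlag W w)
  {φ : Module.Dual ℂ L} {y : ℕ → L} (M : E.IsMover W w φ y)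
include F M

theorem sec_smul_eq {μ : Module.Dual ℂ L} {i : ℕ}
    (h : ∀ j < i, IsRigid W w φ j → E.defect w φ y j μ = 0) :
    ∀ u ∈ W i, (E.sec w φ y i μ • φ) u = μ u := by
  induction i with
  | zero =>
    intro u hu
    rw [F.zero, Submodule.mem_bot] at hu
    simp [hu]
  | succ i ih =>
    specialize ih fun j hj => h j (by omega)
    -- The new exponential acts on `φ` first. The change `κ` vanishes on `W i` and equals the defect
    -- at `w i`; by unipotence the older factors leave it unchanged on `W (i + 1)`.
    set κ := E.exp (E.defect w φ y i μ • y i) • φ - φ with hκ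
    have hsec : E.sec w φ y (i + 1) μ • φ = E.sec w φ y i μ • φ + E.sec w φ y i μ • κ := by
      rw [sec_succ, mul_smul, ← smul_add, hκ, add_sub_cancel]
    have hκ0 : ∀ u ∈ W i, κ u = 0 := fun u hu => by
      rw [hκ, LinearMap.sub_apply, F.exp_smul_eq_of_annihilates (M.annihilates i) _ u hu, sub_self]
    have hκs := F.smul_eq (sec_mem_expGroup (E := E) w φ y i μ) hκ0
    have hκw : κ (w i) = E.defect w φ y i μ := by
      by_cases hr : IsRigid W w φ i
      · rw [hκ, h i (by omega) hr]
        simp [exp_zero]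
      · rw [hκ, LinearMap.sub_apply, E.exp_smul_apply_of_const (c := 1) (fun t => ?_)]
        · ring
        · rw [F.exp_smul_eq_of_annihilates (M.annihilates i) t _ (F.lie_mem _ i), M.moves i hr]
    refine F.eq_on_succ (fun u hu => ?_) ?_
    · rw [hsec, LinearMap.add_apply, hκs u (F.mono i.le_succ hu), hκ0 u hu, ih u hu, add_zero]
    · rw [hsec, LinearMap.add_apply, hκs _ (F.mem_succ_self i), hκw, defect, add_sub_cancel]

/-- It suffices that the defect has zero derivative along `exp (t • x) • g • φ`. The section applied
to `φ` follows this curve on `W i`, so its velocity differs there from that of `x` by an element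
stabilizing `φ` on `W i`. Rigidity makes the two velocities agree at `w i` as well. -/
theorem defect_smul_eq_zero {i : ℕ} (hi : IsRigid W w φ i) :
    ∀ g ∈ E.expGroup, E.defect w φ y i (g • φ) = 0 := by
  induction i using Nat.strong_induction_on with
  | _ i ih =>
  have hsec (g : E.proGroup) (hg : g ∈ E.expGroup) :
      ∀ u ∈ W i, (E.sec w φ y i (g • φ) • φ) u = (g • φ) u :=
    F.sec_smul_eq M fun j hj hr => ih j hj hr g hg
  refine E.expGroup_induction ?_ fun x g hg hd => ?_
  -- For the target `φ` itself, every correction parameter is zero.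
  · have h1 (j : ℕ) : (j ≤ i → E.sec w φ y j φ = 1) := by
      induction j with
      | zero => intro; rfl
      | succ j ihj =>
        intro hj
        rw [sec_succ, defect, ihj (by omega)]
        simp [exp_zero]
    rw [one_smul, defect, h1 i le_rfl]
    simp
  · set μ : ℂ → Module.Dual ℂ L := fun t => E.exp (t • x) • g • φ with hμ
    have hμs (t : ℂ) : ∀ u ∈ W i, (E.sec w φ y i (μ t) • φ) u = μ t u := by
      have := hsec (E.exp (t • x) * g) (mul_mem (E.exp_mem_expGroup _) hg)
      rwa [mul_smul] at this
    obtain ⟨a, ha⟩ := isPath_sec (E := E) w φ y x (g • φ) i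
    have hder (t : ℂ) : HasDerivAt (fun t => E.defect w φ y i (μ t)) 0 t := by
      have hx (v : L) := E.hasDerivAt_exp_smul x (g • φ) v t
      simp only [exp_smul_smul_coadj] at hx
      refine ((hx (w i)).sub (ha t φ (w i))).congr_deriv ?_
      have hs := sec_mem_expGroup (E := E) w φ y i (μ t)
      set s := E.sec w φ y i (μ t)
      obtain ⟨x', hx'⟩ := E.exists_smul_coadj hs x
      -- `x'` is `x` conjugated past `s`, so `a t - x'` measures the difference of the two
      -- velocities before `s` is applied.
      have hb (v : L) : (s • coadj (a t - x') φ) v = (s • coadj (a t) φ) v + (s • φ) ⁅x, v⁆ := by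
        rw [coadj_sub, smul_sub, hx', LinearMap.sub_apply, coadj_apply, sub_neg_eq_add]
      have hb0 : ∀ u ∈ W i, (s • coadj (a t - x') φ) u = 0 := fun u hu => by
        have h1 := (ha t φ u).unique ((hx u).congr_of_eventuallyEq
          (Filter.Eventually.of_forall fun τ => hμs τ u hu))
        have h2 : (s • coadj (a t) φ) u = -(μ t) ⁅x, u⁆ := h1
        rw [hb, h2, hμs t _ (F.lie_mem_of_mem_succ x (F.mono i.le_succ hu)), neg_add_cancel]
      have hb1 : ∀ u ∈ W i, coadj (a t - x') φ u = 0 := fun u hu => by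
        have := F.smul_eq (inv_mem hs) hb0 u (F.mono i.le_succ hu)
        rwa [inv_smul_smul, hb0 u hu] at this
      have hb2 := F.smul_eq hs hb1 _ (F.mem_succ_self i)
      rw [hb, coadj_apply, hi _ (fun u hu => neg_eq_zero.1 (hb1 u hu)), neg_zero,
        hμs t _ (F.lie_mem x i)] at hb2
      change -(μ t) ⁅x, w i⁆ - (s • coadj (a t) φ) (w i) = 0
      linear_combination -hb2
    have h2 := is_const_of_deriv_eq_zero (fun t => (hder t).differentiableAt)
      (fun t => (hder t).deriv) 1 0
    simpa [hμ, exp_zero, hd, mul_smul] using h2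

end IsFlag

end SocleExhaustion

/-! ### Existence of flags, movers and limits in `N̂`. -/

namespace SocleExhaustion

variable {L : Type*} [LieRing L] [LieAlgebra ℂ L] (E : SocleExhaustion L)

theorem exists_lcs_eq_bot (k : ℕ) : ∃ N, LieSubmodule.lcs N (E.ideal k) = ⊥ := by
  have := E.finite k
  rw [← LieSubmodule.isNilpotent_iff_exists_lcs_eq_bot,
    LieModule.isNilpotent_iff_forall' (R := ℂ)]
  exact E.isNilpotent_toEnd k

/-- In the first ideal not inside `W`, take `w` outside `W` in the last term of its lower central
series under the whole Lie algebra that is not inside `W`. If `W` contains every ideal, `w = 0`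
serves. -/
theorem exists_flag_step (W : Submodule ℂ L) :
    ∃ w : L, (∀ x : L, ⁅x, w⁆ ∈ W) ∧ ∀ k, ¬ (E.ideal k).toSubmodule ≤ W →
      (∀ j < k, (E.ideal j).toSubmodule ≤ W) → w ∈ E.ideal k ∧ w ∉ W := by
  classical
  by_cases h : ∃ k, ¬ (E.ideal k).toSubmodule ≤ W
  · have hex : ∃ N, (LieSubmodule.lcs N (E.ideal (Nat.find h))).toSubmodule ≤ W := by
      obtain ⟨N, hN⟩ := E.exists_lcs_eq_bot (Nat.find h)
      exact ⟨N, by simp [hN]⟩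
    obtain ⟨N, hN⟩ : ∃ N, Nat.find hex = N + 1 := by
      refine Nat.exists_eq_succ_of_ne_zero fun h0 => Nat.find_spec h ?_
      simpa [h0] using Nat.find_spec hex
    obtain ⟨w, hw, hwW⟩ := SetLike.not_le_iff_exists.1 (Nat.find_min hex (m := N) (by omega))
    refine ⟨w, fun x => ?_, fun k hk hj => ?_⟩
    · have := Nat.find_spec hex
      rw [hN, LieSubmodule.lcs_succ] at this
      exact this (LieSubmodule.lie_mem_lie (LieSubmodule.mem_top x) hw)
    · have hk' : k = Nat.find h := le_antisymm
        (not_lt.1 fun hlt => Nat.find_spec h (hj _ hlt)) (Nat.find_min' h hk)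
      exact ⟨hk' ▸ LieSubmodule.lcs_le_self N _ hw, hwW⟩
  · push Not at h
    exact ⟨0, fun x => by simp, fun k hk => absurd (h k) hk⟩

theorem exists_isFlag : ∃ (W : ℕ → Submodule ℂ L) (w : ℕ → L), E.IsFlag W w := by
  choose step hstep₁ hstep₂ using E.exists_flag_step
  let T := {W : Submodule ℂ L // ∀ x : L, ∀ v ∈ W, ⁅x, v⁆ ∈ W}
  let next (W : T) : T := ⟨W.1 ⊔ Submodule.span ℂ {step W.1}, fun x v hv => by
    obtain ⟨u, hu, c, rfl⟩ := by simpa [Submodule.mem_sup, Submodule.mem_span_singleton] using hv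
    refine Submodule.mem_sup_left ?_
    rw [lie_add, lie_smul]
    exact add_mem (W.2 x u hu) (Submodule.smul_mem _ _ (hstep₁ _ x))⟩
  let S : ℕ → T := fun i => next^[i] ⟨⊥, fun x v hv => by simp_all⟩
  have hS (i : ℕ) : S (i + 1) = next (S i) := Function.iterate_succ_apply' _ _ _
  refine ⟨fun i => (S i).1, fun i => step (S i).1, rfl,
    fun i => congrArg Subtype.val (hS i), fun x i => hstep₁ _ x, ?_⟩
  -- `n` bounds the dimension still missing from the `k`-th ideal; each step lowers it.
  have key (k : ℕ) : ∀ n d, (S d).1 ≤ (E.ideal k).toSubmodule →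
      (∀ j < k, (E.ideal j).toSubmodule ≤ (S d).1) →
      Module.finrank ℂ (E.ideal k) ≤ Module.finrank ℂ (S d).1 + n →
      ∃ d, (S d).1 = (E.ideal k).toSubmodule := by
    have := E.finite k
    have : FiniteDimensional ℂ (E.ideal k).toSubmodule := E.finite k
    intro n
    induction n with
    | zero => exact fun d h₁ _ h₃ => ⟨d, Submodule.eq_of_le_of_finrank_le h₁ h₃⟩
    | succ n ih =>
      intro d h₁ h₂ h₃
      by_cases hk : (E.ideal k).toSubmodule ≤ (S d).1
      · exact ⟨d, le_antisymm h₁ hk⟩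
      obtain ⟨hw₁, hw₂⟩ := hstep₂ (S d).1 k hk h₂
      have hval : (S (d + 1)).1 = (S d).1 ⊔ Submodule.span ℂ {step (S d).1} :=
        congrArg Subtype.val (hS d)
      have hle : (S d).1 ≤ (S (d + 1)).1 := hval ▸ le_sup_left
      have hle' : (S (d + 1)).1 ≤ (E.ideal k).toSubmodule := by
        rw [hval, sup_le_iff, Submodule.span_singleton_le_iff_mem]
        exact ⟨h₁, hw₁⟩
      have : FiniteDimensional ℂ (S (d + 1)).1 := Submodule.finiteDimensional_of_le hle'
      have hlt : (S d).1 < (S (d + 1)).1 := lt_of_le_of_ne hle fun he =>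
        by
          rw [hval] at he
          exact hw₂ (he.symm.le (Submodule.mem_sup_right (Submodule.mem_span_singleton_self _)))
      have := Submodule.finrank_lt_finrank_of_lt hlt
      exact ih (d + 1) hle' (fun j hj => (h₂ j hj).trans hle) (by omega)
  intro k
  induction k with
  | zero => exact key 0 _ 0 bot_le (by simp) le_add_self
  | succ k ih =>
    obtain ⟨d, hd⟩ := ih
    exact key (k + 1) _ d (hd.trans_le (E.mono k.le_succ))
      (fun j hj => hd ▸ E.mono (Nat.lt_succ_iff.1 hj)) le_add_self

variable {E} in
theorem IsFlag.exists_isMover {W : ℕ → Submodule ℂ L} {w : ℕ → L} (F : E.IsFlag W w)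
    (φ : Module.Dual ℂ L) : ∃ y, E.IsMover W w φ y := by
  let stab (i : ℕ) : Submodule ℂ L :=
    { carrier := {x | ∀ u ∈ W i, φ ⁅x, u⁆ = 0}
      add_mem' := fun {a b} ha hb u hu => by simp [ha u hu, hb u hu]
      zero_mem' := fun u _ => by simp
      smul_mem' := fun c a ha u hu => by simp [ha u hu] }
  let act (k : ℕ) : L →ₗ[ℂ] Module.End ℂ (E.ideal k) :=
    { toFun := fun x => LieModule.toEnd ℂ L (E.ideal k) x
      map_add' := fun a b => by simp
      map_smul' := fun c a => by simp }
  let cent (k : ℕ) : Submodule ℂ L := LinearMap.ker (act k)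
  have hcent {k : ℕ} {x : L} : x ∈ cent k ↔ ∀ v ∈ E.ideal k, ⁅x, v⁆ = 0 := by
    rw [LinearMap.mem_ker, LinearMap.ext_iff]
    exact ⟨fun h v hv => congrArg Subtype.val (h ⟨v, hv⟩), fun h v => Subtype.ext (h v v.2)⟩
  have hstab : ∀ i, stab (i + 1) ≤ stab i := fun i x hx u hu => hx u (F.mono i.le_succ hu)
  -- The images of the decreasing `stab i` in the finite-dimensional space of endomorphisms of the
  -- `k`-th ideal stabilize, and `cent k` is the kernel of the map to it.
  have hst (k : ℕ) : ∃ N, ∀ i ≥ N, stab i ≤ stab (i + 1) ⊔ cent k := by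
    have := E.finite k
    let f : ℕ →o (Submodule ℂ (Module.End ℂ (E.ideal k)))ᵒᵈ :=
      ⟨fun i => OrderDual.toDual
        ((stab i).map (act k)),
        monotone_nat_of_le_succ fun i => Submodule.map_mono (hstab i)⟩
    obtain ⟨N, hN⟩ := IsArtinian.monotone_stabilizes f
    refine ⟨N, fun i hi => ?_⟩
    have h : (stab i).map (act k)
        = (stab (i + 1)).map (act k) :=
      (hN i hi).symm.trans (hN (i + 1) (by omega))
    rw [← Submodule.comap_map_eq, ← h]
    exact Submodule.le_comap_map _ _
  choose N hN using hst
  have hmove (i : ℕ) (hi : ¬ IsRigid W w φ i) (m : ℕ) :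
      ∃ y ∈ stab i, φ ⁅y, w i⁆ = -1 ∧ ∀ k ≤ m, N k ≤ i → y ∈ cent k := by
    have hscale (z : L) (hz : z ∈ stab i) (hzw : φ ⁅z, w i⁆ ≠ 0) :
        (-(φ ⁅z, w i⁆)⁻¹) • z ∈ stab i ∧ φ ⁅(-(φ ⁅z, w i⁆)⁻¹) • z, w i⁆ = -1 :=
      ⟨Submodule.smul_mem _ _ hz, by simp [hzw]⟩
    simp only [IsRigid, not_forall] at hi
    obtain ⟨z, hz, hzw⟩ := hi
    -- Split `z` into a part in `stab (i + 1)` and a part in `cent m`. The former does not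
    -- contribute at `w i`, so the latter moves just as `z` does.
    have hrep (m : ℕ) (hm : N m ≤ i) : ∃ c ∈ cent m, c ∈ stab i ∧ φ ⁅c, w i⁆ ≠ 0 := by
      obtain ⟨a, ha, c, hc, hac⟩ := Submodule.mem_sup.1 (hN m i hm hz)
      refine ⟨c, hc, ?_, ?_⟩
      · rw [← add_sub_cancel_left a c, hac]
        exact sub_mem hz (hstab i ha)
      · rw [← add_sub_cancel_left a c, hac, sub_lie, map_sub, ha _ (F.mem_succ_self i), sub_zero]
        exact hzw
    have hdone (m : ℕ) (hm : N m ≤ i) :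
        ∃ y ∈ stab i, φ ⁅y, w i⁆ = -1 ∧ ∀ k ≤ m, N k ≤ i → y ∈ cent k := by
      obtain ⟨c, hc, hci, hcw⟩ := hrep m hm
      refine ⟨_, (hscale c hci hcw).1, (hscale c hci hcw).2, fun k hk _ => ?_⟩
      exact Submodule.smul_mem _ _ (hcent.2 fun v hv => hcent.1 hc v (E.mono hk hv))
    induction m with
    | zero =>
      by_cases h0 : N 0 ≤ i
      · exact hdone 0 h0
      · refine ⟨_, (hscale z hz hzw).1, (hscale z hz hzw).2, fun k hk hk' => ?_⟩
        obtain rfl := Nat.le_zero.1 hk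
        exact absurd hk' h0
    | succ m ih =>
      by_cases h0 : N (m + 1) ≤ i
      · exact hdone _ h0
      · obtain ⟨y, h₁, h₂, h₃⟩ := ih
        refine ⟨y, h₁, h₂, fun k hk hk' => ?_⟩
        rcases hk.lt_or_eq with hlt | rfl
        · exact h₃ k (by omega) hk'
        · exact absurd hk' h0
  have hall (i : ℕ) : ∃ y ∈ stab i, (¬ IsRigid W w φ i → φ ⁅y, w i⁆ = -1) ∧
      (IsRigid W w φ i → y = 0) ∧ ∀ k ≤ i, N k ≤ i → y ∈ cent k := by
    by_cases hi : IsRigid W w φ i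
    · exact ⟨0, zero_mem _, fun h => absurd hi h, fun _ => rfl, fun _ _ _ => zero_mem _⟩
    · obtain ⟨y, h₁, h₂, h₃⟩ := hmove i hi i
      exact ⟨y, h₁, fun _ => h₂, fun h => absurd h hi, h₃⟩
  choose y h₁ h₂ h₃ h₄ using hall
  exact ⟨y, h₁, h₂, h₃, fun k => ⟨max k (N k), fun i hi =>
    hcent.1 (h₄ i k (le_of_max_le_left hi) (le_of_max_le_right hi))⟩⟩

theorem exists_limit (g : ℕ → E.proGroup)
    (hg : ∀ k, ∃ N, ∀ i ≥ N, (g (i + 1)).1 k = (g i).1 k) :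
    ∃ h : E.proGroup, ∀ k, ∃ N, ∀ i ≥ N, h.1 k = (g i).1 k := by
  choose N hN using hg
  have hc (k i : ℕ) (hi : N k ≤ i) : (g (N k)).1 k = (g i).1 k := by
    induction i, hi using Nat.le_induction with
    | base => rfl
    | succ i hi ih => rw [ih, hN k i hi]
  refine ⟨⟨fun k => (g (N k)).1 k, fun k => (g (N k)).2.1 k, fun k m h φ => ?_⟩,
    fun k => ⟨N k, hc k⟩⟩
  change E.res h ((g (N m)).1 m φ) = (g (N k)).1 k (E.res h φ)
  rw [hc k _ (le_max_left (N k) (N m)), hc m _ (le_max_right (N k) (N m))]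
  exact (g _).2.2 k m h φ

/-! ### Orbits as zero sets of rigid defects. -/

variable {E}

theorem exists_expGroup_val_eq (g : E.proGroup) (k : ℕ) : ∃ h ∈ E.expGroup, g.1 k = h.1 k := by
  have hg : g.1 k ∈ ⋃ l ≥ k, (E.coadImage k l : Set (E.DualAt k ≃ₗ[ℂ] E.DualAt k)) := g.2.1 k
  simp only [Set.mem_iUnion, SetLike.mem_coe] at hg
  obtain ⟨l, -, hg⟩ := hg
  rw [coadImage] at hg
  generalize g.1 k = a at hg ⊢
  induction hg using Subgroup.closure_induction with
  | mem a ha =>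
    obtain ⟨x, -, hx⟩ := ha
    exact ⟨E.exp x, E.exp_mem_expGroup x, (E.eq_expAt_iff k x a).1 hx⟩
  | one => exact ⟨1, one_mem _, rfl⟩
  | mul a b _ _ ha hb =>
    obtain ⟨c, hc, rfl⟩ := ha
    obtain ⟨d, hd, rfl⟩ := hb
    exact ⟨c * d, mul_mem hc hd, rfl⟩
  | inv a _ ha =>
    obtain ⟨c, hc, rfl⟩ := ha
    exact ⟨c⁻¹, inv_mem hc, rfl⟩

theorem exists_expGroup_smul_eq (g : E.proGroup) (φ : Module.Dual ℂ L) (k : ℕ) :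
    ∃ h ∈ E.expGroup, E.resTop k (g • φ) = E.resTop k (h • φ) := by
  obtain ⟨h, hh, hk⟩ := exists_expGroup_val_eq g k
  exact ⟨h, hh, by rw [resTop_smul, resTop_smul, hk]⟩

namespace IsFlag

variable {W : ℕ → Submodule ℂ L} {w : ℕ → L} (F : E.IsFlag W w)
  {φ : Module.Dual ℂ L} {y : ℕ → L} (M : E.IsMover W w φ y)
include F

theorem exists_le_ideal (i : ℕ) : ∃ k, W i ≤ (E.ideal k).toSubmodule := by
  induction i with
  | zero => exact ⟨0, by simp [F.zero]⟩
  | succ i ih =>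
    obtain ⟨k, hk⟩ := ih
    obtain ⟨l, hl⟩ := E.exhausts (w i)
    refine ⟨max k l, ?_⟩
    rw [F.succ, sup_le_iff, Submodule.span_singleton_le_iff_mem]
    exact ⟨hk.trans (E.mono (le_max_left k l)), E.mono (le_max_right k l) hl⟩

theorem defect_eq_of_resTop_eq (φ : Module.Dual ℂ L) (y : ℕ → L) {i k : ℕ}
    (hi : W (i + 1) ≤ (E.ideal k).toSubmodule) {μ ν : Module.Dual ℂ L}
    (h : E.resTop k μ = E.resTop k ν) : E.defect w φ y i μ = E.defect w φ y i ν :=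
  defect_congr w φ y fun j hj => LinearMap.congr_fun h
    ⟨w j, hi (F.mono (Nat.succ_le_succ hj) (F.mem_succ_self j))⟩

include M

/-- An orbit of `N̂` is the common zero set of the defects at the rigid steps. -/
theorem mem_orbit_iff {μ : Module.Dual ℂ L} : μ ∈ MulAction.orbit E.proGroup φ ↔
    ∀ i, IsRigid W w φ i → E.defect w φ y i μ = 0 := by
  constructor
  · rintro ⟨g, rfl⟩ i hi
    obtain ⟨k, hk⟩ := F.exists_le_ideal (i + 1)
    obtain ⟨h, hh, hgh⟩ := exists_expGroup_smul_eq g φ k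
    exact (F.defect_eq_of_resTop_eq φ y hk hgh).trans (F.defect_smul_eq_zero M hi h hh)
  · intro h
    obtain ⟨g, hg⟩ := E.exists_limit (fun i => E.sec w φ y i μ) fun k => by
      obtain ⟨N, hN⟩ := M.eventually k
      refine ⟨N, fun i hi => ?_⟩
      have : (E.exp (E.defect w φ y i μ • y i)).1 k = 1 :=
        E.exp_val_eq_one fun v hv => by simp [hN i hi v hv]
      rw [sec_succ, Subgroup.coe_mul, Pi.mul_apply, this, mul_one]
    refine ⟨g, E.ext_resTop fun k => ?_⟩
    obtain ⟨N, hN⟩ := hg k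
    obtain ⟨d, hd⟩ := F.exhausts k
    change E.resTop k (g • φ) = _
    rw [resTop_smul, hN (max N d) (le_max_left _ _), ← resTop_smul]
    ext v
    exact F.sec_smul_eq M (fun j _ => h j) v
      (F.mono (le_max_right N d) (hd ▸ v.2))

end IsFlag

end SocleExhaustion

/-! ### Rules for the Poisson bracket. -/

section Poisson

variable {L : Type*} [LieRing L] [LieAlgebra ℂ L]

theorem poissonBracket_add_left (f f' g : SymmetricAlgebra ℂ L) :
    poissonBracket (f + f') g = poissonBracket f g + poissonBracket f' g := by
  simp [poissonBracket]

theorem poissonBracket_add_right (f g g' : SymmetricAlgebra ℂ L) :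
    poissonBracket f (g + g') = poissonBracket f g + poissonBracket f g' := by
  simp [poissonBracket]

theorem poissonBracket_mul_left (f f' g : SymmetricAlgebra ℂ L) :
    poissonBracket (f * f') g = f * poissonBracket f' g + f' * poissonBracket f g := by
  simp [poissonBracket]

theorem poissonBracket_mul_right (f g g' : SymmetricAlgebra ℂ L) :
    poissonBracket f (g * g') = g * poissonBracket f g' + g' * poissonBracket f g := by
  simp [poissonBracket]

theorem poissonBracket_algebraMap_left (c : ℂ) (g : SymmetricAlgebra ℂ L) :
    poissonBracket (algebraMap ℂ _ c) g = 0 := by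
  simp [poissonBracket]

theorem poissonBracket_algebraMap_right (f : SymmetricAlgebra ℂ L) (c : ℂ) :
    poissonBracket f (algebraMap ℂ _ c) = 0 := by
  simp [poissonBracket]

theorem isPoissonIdeal_of_ι {J : Ideal (SymmetricAlgebra ℂ L)}
    (h : ∀ x : L, ∀ g ∈ J, poissonBracket (SymmetricAlgebra.ι ℂ L x) g ∈ J) :
    IsPoissonIdeal J := by
  intro f g hg
  induction f using SymmetricAlgebra.induction with
  | algebraMap c => simp [poissonBracket_algebraMap_left]
  | ι x => exact h x g hg
  | mul a b ha hb =>
    rw [poissonBracket_mul_left]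
    exact add_mem (J.mul_mem_left _ hb) (J.mul_mem_left _ ha)
  | add a b ha hb => rw [poissonBracket_add_left]; exact add_mem ha hb

theorem evalAt_ι {V : Type*} [AddCommGroup V] [Module ℂ V] (μ : Module.Dual ℂ V) (v : V) :
    evalAt μ (SymmetricAlgebra.ι ℂ V v) = μ v := by
  simp [evalAt]

end Poisson

/-! ### Polynomiality of the defects and closedness of restricted orbits. -/

namespace SocleExhaustion

variable {L : Type*} [LieRing L] [LieAlgebra ℂ L] (E : SocleExhaustion L)

/-- The inclusion of the symmetric algebra of the `k`-th ideal into that of `n`. -/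
noncomputable def symInclusion (k : ℕ) :
    SymmetricAlgebra ℂ (E.ideal k) →ₐ[ℂ] SymmetricAlgebra ℂ L :=
  SymmetricAlgebra.lift (SymmetricAlgebra.ι ℂ L ∘ₗ (E.ideal k).toSubmodule.subtype)

theorem evalAt_symInclusion (k : ℕ) (μ : Module.Dual ℂ L) (p : SymmetricAlgebra ℂ (E.ideal k)) :
    evalAt μ (E.symInclusion k p) = evalAt (E.resTop k μ) p := by
  have : (evalAt μ).comp (E.symInclusion k) = evalAt (E.resTop k μ) := by
    apply SymmetricAlgebra.algHom_ext
    ext v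
    simp [symInclusion, evalAt, resTop_apply]
    rfl
  exact DFunLike.congr_fun this p

/-- The functions on `n*` given by the elements of the symmetric algebra of the `k`-th ideal. -/
noncomputable def polyFun (k : ℕ) : Subalgebra ℂ (Module.Dual ℂ L → ℂ) :=
  (AlgHom.pi fun μ : Module.Dual ℂ L => evalAt (E.resTop k μ)).range

variable {E}

theorem mem_polyFun {k : ℕ} {f : Module.Dual ℂ L → ℂ} :
    f ∈ E.polyFun k ↔ ∃ p, ∀ μ, evalAt (E.resTop k μ) p = f μ :=
  ⟨fun ⟨p, hp⟩ => ⟨p, fun μ => congrFun hp μ⟩, fun ⟨p, hp⟩ => ⟨p, funext hp⟩⟩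

theorem eval_mem_polyFun {k : ℕ} {v : L} (hv : v ∈ E.ideal k) :
    (fun μ : Module.Dual ℂ L => μ v) ∈ E.polyFun k :=
  mem_polyFun.2 ⟨SymmetricAlgebra.ι ℂ _ ⟨v, hv⟩, fun μ => by rw [evalAt_ι]; rfl⟩

theorem exp_smul_mem_polyFun {k : ℕ} {d : Module.Dual ℂ L → ℂ} (hd : d ∈ E.polyFun k) (x : L)
    (ψ : Module.Dual ℂ L) (v : L) : (fun μ => (E.exp (d μ • x) • ψ) v) ∈ E.polyFun k := by
  obtain ⟨P, hP⟩ := E.exists_polynomial_exp_smul x ψ v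
  convert (Polynomial.aeval (⟨d, hd⟩ : E.polyFun k) P).2 using 1
  ext μ
  rw [(hP _).1]
  exact (Polynomial.aeval_algHom_apply
    ((Pi.evalAlgHom ℂ (fun _ : Module.Dual ℂ L => ℂ) μ).comp (E.polyFun k).val) ⟨d, hd⟩ P)

/-- Each new factor substitutes the defect, polynomial by induction, into a polynomial one-parameter
curve. The claim is made for every `ψ`, since expanding the product in dual bases needs the older
section on each `β j`. -/
theorem sec_smul_mem_polyFun {W : ℕ → Submodule ℂ L} {w : ℕ → L} (F : E.IsFlag W w)
    (φ : Module.Dual ℂ L) (y : ℕ → L) {k : ℕ} {i : ℕ} (hi : W i ≤ (E.ideal k).toSubmodule) :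
    ∀ (ψ : Module.Dual ℂ L), ∀ v ∈ E.ideal k,
      (fun μ => (E.sec w φ y i μ • ψ) v) ∈ E.polyFun k := by
  induction i with
  | zero =>
    intro ψ v _
    simp only [sec, one_smul]
    exact (E.polyFun k).algebraMap_mem (ψ v)
  | succ i ih =>
    intro ψ v hv
    specialize ih ((F.mono i.le_succ).trans hi)
    obtain ⟨n, b, β, hb, h⟩ := E.exists_dual_bases k
    have hw : w i ∈ E.ideal k := hi (F.mem_succ_self i)
    have hd : E.defect w φ y i ∈ E.polyFun k := sub_mem (eval_mem_polyFun hw) (ih φ _ hw)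
    have heq : (fun μ => (E.sec w φ y (i + 1) μ • ψ) v)
        = ∑ j, (fun μ => (E.exp (E.defect w φ y i μ • y i) • ψ) (b j))
          * fun μ => (E.sec w φ y i μ • β j) v := by
      ext μ
      rw [sec_succ, mul_smul, E.smul_apply_eq_sum h _ _ hv]
      simp
    rw [heq]
    exact sum_mem fun j _ => mul_mem (exp_smul_mem_polyFun hd _ _ _) (ih _ v hv)

theorem defect_mem_polyFun {W : ℕ → Submodule ℂ L} {w : ℕ → L} (F : E.IsFlag W w)
    (φ : Module.Dual ℂ L) (y : ℕ → L) {k i : ℕ} (hi : W (i + 1) ≤ (E.ideal k).toSubmodule) :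
    E.defect w φ y i ∈ E.polyFun k :=
  have hw : w i ∈ E.ideal k := hi (F.mem_succ_self i)
  sub_mem (eval_mem_polyFun hw)
    (sec_smul_mem_polyFun F φ y ((F.mono i.le_succ).trans hi) φ _ hw)

variable (E) in
theorem exists_extension {k : ℕ} (κ : E.DualAt k) : ∃ μ : Module.Dual ℂ L, E.resTop k μ = κ :=
  LinearMap.exists_extend (p := (E.ideal k).toSubmodule) κ

section Orbit

variable {W : ℕ → Submodule ℂ L} {w : ℕ → L} (F : E.IsFlag W w)
  {φ : Module.Dual ℂ L} {y : ℕ → L} (M : E.IsMover W w φ y)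
include F M

/-- Only steps inside the `k`-th ideal matter: once their rigid defects vanish, a finite section
already carries `φ` to `μ` on that ideal, whatever happens further up. -/
theorem IsFlag.mem_resTop_image_orbit_iff {k : ℕ} {μ : Module.Dual ℂ L} :
    E.resTop k μ ∈ E.resTop k '' MulAction.orbit E.proGroup φ ↔
      ∀ i, W (i + 1) ≤ (E.ideal k).toSubmodule → IsRigid W w φ i → E.defect w φ y i μ = 0 := by
  constructor
  · rintro ⟨ν, hν, hνμ⟩ i hi hr
    rw [← F.defect_eq_of_resTop_eq φ y hi hνμ]
    exact (F.mem_orbit_iff M).1 hν i hr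
  · intro h
    obtain ⟨d, hd⟩ := F.exhausts k
    refine ⟨E.sec w φ y d μ • φ, ⟨_, rfl⟩, LinearMap.ext fun v => ?_⟩
    exact F.sec_smul_eq M (i := d)
      (fun j hj hr => h j (hd ▸ F.mono (Nat.succ_le_of_lt hj)) hr) v (hd ▸ v.2)

theorem IsFlag.isClosed_resTop_image_orbit (k : ℕ) :
    IsClosed[symZariski (E.ideal k)] (E.resTop k '' MulAction.orbit E.proGroup φ) := by
  rw [isClosed_symZariski_iff]
  refine ⟨{p | ∃ i, W (i + 1) ≤ (E.ideal k).toSubmodule ∧ IsRigid W w φ i ∧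
    ∀ μ, evalAt (E.resTop k μ) p = E.defect w φ y i μ}, Set.ext fun κ => ?_⟩
  obtain ⟨μ, rfl⟩ := E.exists_extension κ
  rw [F.mem_resTop_image_orbit_iff M]
  constructor
  · rintro h p ⟨i, hi, hr, hp⟩
    rw [hp, h i hi hr]
  · intro h i hi hr
    obtain ⟨p, hp⟩ := mem_polyFun.1 (defect_mem_polyFun F φ y hi)
    rw [← hp]
    exact h p ⟨i, hi, hr, hp⟩

theorem IsFlag.orbit_eq : MulAction.orbit E.proGroup φ
    = {μ | ∀ k, E.resTop k μ ∈ E.resTop k '' MulAction.orbit E.proGroup φ} := by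
  refine Set.Subset.antisymm (fun μ hμ k => ⟨μ, hμ, rfl⟩) fun μ hμ => ?_
  rw [F.mem_orbit_iff M]
  intro i hi
  obtain ⟨k, hk⟩ := F.exists_le_ideal (i + 1)
  exact (F.mem_resTop_image_orbit_iff M).1 (hμ k) i hk hi

end Orbit

/-! ### Pro-subvarieties, Poisson ideals and orbits. -/

variable (E)

theorem isProSubvariety_orbit (φ : Module.Dual ℂ L) :
    E.IsProSubvariety (MulAction.orbit E.proGroup φ) := by
  obtain ⟨W, w, F⟩ := E.exists_isFlag
  obtain ⟨y, M⟩ := F.exists_isMover φ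
  -- The restricted orbits are themselves closed, so the transition maps are even surjective.
  refine ⟨fun k => E.resTop k '' MulAction.orbit E.proGroup φ,
    fun k => F.isClosed_resTop_image_orbit M k, fun k m h => ?_, F.orbit_eq M⟩
  have : E.res h '' (E.resTop m '' MulAction.orbit E.proGroup φ)
      = E.resTop k '' MulAction.orbit E.proGroup φ := by
    rw [Set.image_image]
    rfl
  rw [this]
  exact @IsClosed.closure_eq _ (symZariski (E.ideal k)) _ (F.isClosed_resTop_image_orbit M k)

variable {E} in
theorem IsProSubvariety.isClosed {Z : Set (Module.Dual ℂ L)} (h : E.IsProSubvariety Z) :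
    IsClosed[symZariski L] Z := by
  obtain ⟨X, hX, -, rfl⟩ := h
  choose S hS using fun k => (isClosed_symZariski_iff (X k)).1 (hX k)
  rw [isClosed_symZariski_iff]
  refine ⟨⋃ k, E.symInclusion k '' S k, Set.ext fun μ => ?_⟩
  constructor
  · intro h f hf
    obtain ⟨k, p, hp, rfl⟩ := Set.mem_iUnion.1 hf
    have hk := h k
    rw [hS k] at hk
    rw [evalAt_symInclusion]
    exact hk p hp
  · intro h k
    rw [hS k]
    intro p hp
    rw [← evalAt_symInclusion]
    exact h _ (Set.mem_iUnion.2 ⟨k, p, hp, rfl⟩)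

theorem exists_polynomial_evalAt (x : L) (μ : Module.Dual ℂ L) (f : SymmetricAlgebra ℂ L) :
    ∃ P : Polynomial ℂ, ∀ t : ℂ, evalAt (E.exp (t • x) • μ) f = P.eval t ∧
      evalAt (E.exp (t • x) • μ) (poissonBracket (SymmetricAlgebra.ι ℂ L x) f)
        = -(Polynomial.derivative P).eval t := by
  induction f using SymmetricAlgebra.induction with
  | algebraMap c =>
    exact ⟨Polynomial.C c, fun t => by simp [poissonBracket_algebraMap_right]⟩
  | ι v =>
    obtain ⟨P, hP⟩ := E.exists_polynomial_exp_smul x μ v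
    refine ⟨P, fun t => ⟨by rw [evalAt_ι, (hP t).1], ?_⟩⟩
    rw [poissonBracket_ι, evalAt_ι, ← (hP t).2, exp_smul_smul_coadj, coadj_apply, neg_neg]
  | mul a b ha hb =>
    obtain ⟨P, hP⟩ := ha
    obtain ⟨Q, hQ⟩ := hb
    refine ⟨P * Q, fun t => ⟨by simp [(hP t).1, (hQ t).1], ?_⟩⟩
    rw [poissonBracket_mul_right, map_add, map_mul, map_mul, (hP t).1, (hP t).2, (hQ t).1,
      (hQ t).2, Polynomial.derivative_mul]
    simp only [Polynomial.eval_add, Polynomial.eval_mul]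
    ring
  | add a b ha hb =>
    obtain ⟨P, hP⟩ := ha
    obtain ⟨Q, hQ⟩ := hb
    refine ⟨P + Q, fun t => ⟨by simp [(hP t).1, (hQ t).1], ?_⟩⟩
    rw [poissonBracket_add_right, map_add, (hP t).2, (hQ t).2, Polynomial.derivative_add,
      Polynomial.eval_add]
    ring

/-- Along `exp (t • x) • μ` an element of `I` is a polynomial in `t`, and minus its derivative comes
from `{x, f} ∈ I`. Induction on the degree makes the derivative zero, and the constant that remains
is `f(μ) = 0`. -/
theorem evalAt_exp_smul_eq_zero {I : Ideal (SymmetricAlgebra ℂ L)} (hI : IsPoissonIdeal I)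
    {μ : Module.Dual ℂ L} (h : ∀ f ∈ I, evalAt μ f = 0) (x : L) :
    ∀ f ∈ I, evalAt (E.exp x • μ) f = 0 := by
  have key (n : ℕ) : ∀ f ∈ I, ∀ P : Polynomial ℂ, P.natDegree ≤ n →
      (∀ t : ℂ, evalAt (E.exp (t • x) • μ) f = P.eval t) → P = 0 := by
    induction n with
    | zero =>
      intro f hf P hn hP
      rw [Polynomial.eq_C_of_natDegree_le_zero hn] at hP ⊢
      have := hP 0
      rw [zero_smul, exp_zero, one_smul, h f hf, Polynomial.eval_C] at this
      rw [← this, Polynomial.C_0]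
    | succ n ih =>
      intro f hf P hn hP
      obtain ⟨Q, hQ⟩ := E.exists_polynomial_evalAt x μ f
      obtain rfl : P = Q := Polynomial.funext fun t => by rw [← hP, (hQ t).1]
      have hder := ih _ (hI (SymmetricAlgebra.ι ℂ L x) f hf) (-Polynomial.derivative P)
        (by
          rw [Polynomial.natDegree_neg]
          exact (Polynomial.natDegree_derivative_le P).trans (by omega))
        (fun t => by rw [(hQ t).2, Polynomial.eval_neg])
      have hdeg := Polynomial.derivative_eq_zero.1 (neg_eq_zero.1 hder)
      rw [Polynomial.eq_C_of_natDegree_eq_zero hdeg] at hP ⊢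
      have := hP 0
      rw [zero_smul, exp_zero, one_smul, h f hf, Polynomial.eval_C] at this
      rw [← this, Polynomial.C_0]
  intro f hf
  obtain ⟨P, hP⟩ := E.exists_polynomial_evalAt x μ f
  have := (hP 1).1
  rwa [key _ f hf P le_rfl fun t => (hP t).1, one_smul, Polynomial.eval_zero] at this

/-- An element of the symmetric algebra involves finitely many vectors. This allows replacing an
element of `N̂` by a product of exponentials when evaluating `f`. -/
theorem exists_evalAt_eq (f : SymmetricAlgebra ℂ L) : ∃ k, ∀ μ ν : Module.Dual ℂ L,
    E.resTop k μ = E.resTop k ν → evalAt μ f = evalAt ν f := by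
  have hres {k l : ℕ} (h : k ≤ l) {μ ν : Module.Dual ℂ L} (hl : E.resTop l μ = E.resTop l ν) :
      E.resTop k μ = E.resTop k ν := by
    rw [← E.res_resTop h, hl, E.res_resTop h]
  induction f using SymmetricAlgebra.induction with
  | algebraMap c => exact ⟨0, fun μ ν _ => by simp⟩
  | ι v =>
    obtain ⟨k, hv⟩ := E.exhausts v
    exact ⟨k, fun μ ν h => by rw [evalAt_ι, evalAt_ι]; exact LinearMap.congr_fun h ⟨v, hv⟩⟩
  | mul a b ha hb =>
    obtain ⟨k, hk⟩ := ha
    obtain ⟨l, hl⟩ := hb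
    exact ⟨max k l, fun μ ν h => by
      rw [map_mul, map_mul, hk μ ν (hres (le_max_left _ _) h), hl μ ν (hres (le_max_right _ _) h)]⟩
  | add a b ha hb =>
    obtain ⟨k, hk⟩ := ha
    obtain ⟨l, hl⟩ := hb
    exact ⟨max k l, fun μ ν h => by
      rw [map_add, map_add, hk μ ν (hres (le_max_left _ _) h), hl μ ν (hres (le_max_right _ _) h)]⟩

theorem orbit_subset_commonZeros {I : Ideal (SymmetricAlgebra ℂ L)} (hI : IsPoissonIdeal I)
    {φ : Module.Dual ℂ L} (h : I ≤ idealAt φ) :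
    MulAction.orbit E.proGroup φ ⊆ commonZeros (I : Set (SymmetricAlgebra ℂ L)) := by
  rintro _ ⟨g, rfl⟩ f hf
  have hexp : ∀ h ∈ E.expGroup, ∀ f ∈ I, evalAt (h • φ) f = 0 :=
    E.expGroup_induction (fun f hf => by rw [one_smul]; exact h hf) fun x g _ ih f hf => by
      rw [mul_smul]
      exact E.evalAt_exp_smul_eq_zero hI ih x f hf
  obtain ⟨k, hk⟩ := E.exists_evalAt_eq f
  obtain ⟨h, hh, hgh⟩ := exists_expGroup_smul_eq g φ k
  exact (hk _ _ hgh).trans (hexp h hh f hf)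

/-- An element vanishing on an invariant set vanishes along each curve `exp (t • x) • μ` in it, so
its derivative at `t = 0`, which is minus the value of `{x, f}`, is zero too. -/
theorem exists_isPoissonIdeal_of_exp_smul_mem {Z : Set (Module.Dual ℂ L)}
    (hZ : ∀ x : L, ∀ μ ∈ Z, E.exp x • μ ∈ Z) :
    ∃ J : Ideal (SymmetricAlgebra ℂ L), IsPoissonIdeal J ∧
      ∀ f, f ∈ J ↔ ∀ μ ∈ Z, evalAt μ f = 0 := by
  let J : Ideal (SymmetricAlgebra ℂ L) := ⨅ μ ∈ Z, idealAt μ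
  have hJ (f : SymmetricAlgebra ℂ L) : f ∈ J ↔ ∀ μ ∈ Z, evalAt μ f = 0 := by
    simp [J, idealAt]
  refine ⟨J, isPoissonIdeal_of_ι fun x g hg => (hJ _).2 fun μ hμ => ?_, hJ⟩
  obtain ⟨P, hP⟩ := E.exists_polynomial_evalAt x μ g
  have hP0 : P = 0 := Polynomial.funext fun t => by
    rw [← (hP t).1, (hJ g).1 hg _ (hZ _ _ hμ), Polynomial.eval_zero]
  have := (hP 0).2
  rwa [zero_smul, exp_zero, one_smul, hP0, Polynomial.derivative_zero, Polynomial.eval_zero,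
    neg_zero] at this

theorem orbit_eq_commonZeros_poissonCore (φ : Module.Dual ℂ L) : MulAction.orbit E.proGroup φ
    = commonZeros (poissonCore φ : Set (SymmetricAlgebra ℂ L)) := by
  have hcore := poissonCore_isGreatest φ
  refine Set.Subset.antisymm (E.orbit_subset_commonZeros hcore.1.1 hcore.1.2) ?_
  obtain ⟨J, hJ, hJmem⟩ := E.exists_isPoissonIdeal_of_exp_smul_mem
    (Z := MulAction.orbit E.proGroup φ) fun x μ hμ => by
      obtain ⟨g, rfl⟩ := hμ
      exact ⟨E.exp x * g, mul_smul _ _ _⟩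
  have hle : J ≤ poissonCore φ :=
    hcore.2 ⟨hJ, fun f hf => (hJmem f).1 hf φ (MulAction.mem_orbit_self φ)⟩
  obtain ⟨S, hS⟩ := (isClosed_symZariski_iff _).1 (E.isProSubvariety_orbit φ).isClosed
  intro μ hμ
  rw [hS]
  intro f hf
  refine hμ f (hle ((hJmem f).2 fun ν hν => ?_))
  rw [hS] at hν
  exact hν f hf

end SocleExhaustion

theorem lemma3p33 {L : Type*} [LieRing L] [LieAlgebra ℂ L] (E : SocleExhaustion L)
    (Ω : Set (Module.Dual ℂ L))
    (hΩ : ∃ lam₀ : Module.Dual ℂ L, Ω = MulAction.orbit E.proGroup lam₀) :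
    IsClosed[symZariski L] Ω ∧ E.IsProSubvariety Ω ∧
      ∀ lam ∈ Ω, Ω = commonZeros (poissonCore lam : Set (SymmetricAlgebra ℂ L)) := by
  obtain ⟨φ, rfl⟩ := hΩ
  refine ⟨(E.isProSubvariety_orbit φ).isClosed, E.isProSubvariety_orbit φ, fun lam hlam => ?_⟩
  rw [← E.orbit_eq_commonZeros_poissonCore, MulAction.orbit_eq_iff.2 hlam]
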